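/- Let $\mathrm{polylog}$ factors be written as $(1+\log n)^k$. All streams below describe a connected simple undirected graph $G$ on the $n$ known nodes $\{1,\dots,n\}$; a $p$-pass streaming algorithm is given $n$, $p$ and a source node $s$, reads the stream $p$ times from beginning to end in the same order, and its space is the number of bits of memory that it keeps between consecutive items of the stream (random bits that are to be reused are part of the memory; the computation performed on a single item is not restricted, and the algorithm may be chosen separately for each pair $(n,p)$). A BFS tree of $G$ rooted at $s$ is a spanning tree $T$ of $G$ with $\operatorname{dist}_T(s,v)=\operatorname{dist}_G(s,v)$ for all nodes $v$. (1) Turnstile model: the stream is a finite sequence, of any length, of insertions and deletions of edges, in which no copy of an edge is deleted unless one is present, and the edges present at the end are exactly the edges of $G$, each once. For every constant $c\in\mathbb N$ there are constants $C$ and $k$ such that for all integers $n$ and $p$ with $1\le p\le\sqrt n$ there is a randomized $p$-pass streaming algorithm with at most $C\,(n/p)^2(1+\log n)^k$ bits of space, that is, $\tilde O((n/p)^2)$ space, which, for every connected simple graph $G$ on $n$ nodes, every source node $s$ and every turnstile stream of $G$, outputs a BFS tree of $G$ rooted at $s$ with probability at least $1-1/n^{c}$. (2) Insertion-only model: the stream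 lists every edge of $G$ exactly once, in any order. There are constants $C$ and $k$ such that for all integers $n$ and $p$ with $1\le p\le\sqrt n$ there is a deterministic $p$-pass streaming algorithm with at most $C\,(n^2/p)(1+\log n)^k$ bits of space, that is, $\tilde O(n^2/p)$ space, which, for every connected simple graph $G$ on $n$ nodes, every source node $s$ and every insertion-only stream of $G$, outputs a BFS tree of $G$ rooted at $s$. -/

import Mathlib

/-! Multi-pass streaming algorithms for graphs on the node set `Fin n`.

Edges arrive one by one, and the stream is read several times in the same order.  Between two items
the algorithm keeps nothing but `S` bits of memory; `S` is its space.  The computation done on one item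
is not restricted otherwise (for a fixed `n` every algorithm below is a finite table).  Coins are
tossed afresh at each transition: a random bit that is to be used again has to be kept in the memory,
and is counted there. -/

namespace GraphStream

/-- `S` bits of memory. -/
abbrev Memory (S : ℕ) : Type := Fin S → Bool

/-! ### Streams -/

/-- An item of a stream with insertions and deletions of edges. -/
inductive Update (n : ℕ) : Type
  | insert (e : Sym2 (Fin n)) : Update n
  | delete (e : Sym2 (Fin n)) : Update n

/-- The edge that an item concerns. -/
def Update.edge {n : ℕ} : Update n → Sym2 (Fin n)
  | .insert e => e
  | .delete e => e

/-- `+1` for an insertion and `-1` for a deletion. -/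
def Update.sign {n : ℕ} : Update n → ℤ
  | .insert _ => 1
  | .delete _ => -1

/-- The multiplicity of the edge `e` after all items of `σ`: insertions minus deletions. -/
def netCount {n : ℕ} (σ : List (Update n)) (e : Sym2 (Fin n)) : ℤ :=
  (σ.map fun u => if u.edge = e then u.sign else 0).sum

/-- `σ` is a stream of the simple graph `G` in the turnstile model: no item is a loop, no copy of an
edge is deleted unless one is present, and the edges present at the end are exactly those of `G`. -/
structure IsTurnstileStream {n : ℕ} (G : SimpleGraph (Fin n)) (σ : List (Update n)) : Prop where
  loopless : ∀ u ∈ σ, ¬ u.edge.IsDiag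
  nonneg : ∀ τ : List (Update n), τ <+: σ → ∀ e, 0 ≤ netCount τ e
  final_mem : ∀ e ∈ G.edgeSet, netCount σ e = 1
  final_notMem : ∀ e ∉ G.edgeSet, netCount σ e = 0

/-- `σ` is a stream of the simple graph `G` in the insertion-only model: a list of the edges of `G`,
each once, in any order. -/
def IsInsertionStream {n : ℕ} (G : SimpleGraph (Fin n)) (σ : List (Sym2 (Fin n))) : Prop :=
  σ.Nodup ∧ ∀ e, e ∈ σ ↔ e ∈ G.edgeSet

/-! ### Deterministic algorithms -/

/-- A deterministic streaming algorithm for `n`-node graphs with `S` bits of memory, for streams with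
items in `α`.  It is given a source node, and it outputs a graph on the same nodes. -/
structure DetAlgorithm (n S : ℕ) (α : Type) where
  /-- the memory before the first pass, for a given source node -/
  init : Fin n → Memory S
  /-- the new memory after an item is read -/
  update : Memory S → α → Memory S
  /-- the new memory after the end of the stream is reached -/
  endPass : Memory S → Memory S
  /-- the output, read off the memory after the last pass -/
  output : Memory S → SimpleGraph (Fin n)

namespace DetAlgorithm

variable {n S : ℕ} {α : Type}

/-- One pass over the stream `σ`. -/
def pass (A : DetAlgorithm n S α) (σ : List α) (m : Memory S) : Memory S :=
  A.endPass (σ.foldl A.update m)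

/-- The output after `p` passes over the stream `σ`, for the source node `s`. -/
def run (A : DetAlgorithm n S α) (p : ℕ) (s : Fin n) (σ : List α) : SimpleGraph (Fin n) :=
  A.output ((A.pass σ)^[p] (A.init s))

end DetAlgorithm

/-! ### Randomized algorithms -/

/-- `r` independent tosses of a fair coin. -/
noncomputable def tosses (r : ℕ) : PMF (Fin r → Bool) := PMF.uniformOfFintype _

/-- A randomized streaming algorithm for `n`-node graphs with `S` bits of memory, for streams with
items in `α`.  Each transition may depend on `coins` fresh coin tosses. -/
structure RandAlgorithm (n S : ℕ) (α : Type) where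
  /-- the number of coins that are tossed at each transition -/
  coins : ℕ
  /-- the memory before the first pass, for a given source node -/
  init : Fin n → (Fin coins → Bool) → Memory S
  /-- the new memory after an item is read -/
  update : Memory S → α → (Fin coins → Bool) → Memory S
  /-- the new memory after the end of the stream is reached -/
  endPass : Memory S → (Fin coins → Bool) → Memory S
  /-- the output, read off the memory after the last pass -/
  output : Memory S → SimpleGraph (Fin n)

namespace RandAlgorithm

variable {n S : ℕ} {α : Type}

/-- The law of the memory after one pass over a stream, started with memory `m`. -/
noncomputable def pass (A : RandAlgorithm n S α) : List α → Memory S → PMF (Memory S)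
  | [], m => (tosses A.coins).map (A.endPass m)
  | a :: σ, m => ((tosses A.coins).map (A.update m a)).bind (A.pass σ)

/-- The law of the memory after `p` passes over the stream `σ`, for the source node `s`. -/
noncomputable def memoryLaw (A : RandAlgorithm n S α) (s : Fin n) (σ : List α) :
    ℕ → PMF (Memory S)
  | 0 => (tosses A.coins).map (A.init s)
  | p + 1 => (A.memoryLaw s σ p).bind (A.pass σ)

/-- The law of the output after `p` passes over the stream `σ`, for the source node `s`. -/
noncomputable def run (A : RandAlgorithm n S α) (p : ℕ) (s : Fin n) (σ : List α) :
    PMF (SimpleGraph (Fin n)) :=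
  (A.memoryLaw s σ p).map A.output

end RandAlgorithm

/-- `T` is a breadth-first-search tree of `G` rooted at `s`: a spanning tree of `G` in which every node
has the same distance from `s` as in `G`. -/
structure IsBFSTree {n : ℕ} (G : SimpleGraph (Fin n)) (s : Fin n) (T : SimpleGraph (Fin n)) :
    Prop where
  le : T ≤ G
  isTree : T.IsTree
  dist_eq : ∀ v, T.dist s v = G.dist s v

end GraphStream

/-! Every pass is used for a linear query: each edge contributes a vector depending on what is
already in memory, and deletions cancel. Space is counted as the number of pairs (knowledge, partial
answer), and `Step.cons` chains passes as soon as knowledge plus answer determines the next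
knowledge; no explicit decoding is needed. Two queries suffice: counts of neighbours modulo a prime
above n, and power sums recovering a sparse vector (`exists_sparse_sketch`). Once all distances are
known, about log n passes of binary search find the parents (`findsBFSTree_of_dist`). If p is below
a multiple of log n, the whole graph is stored instead.

Deterministic part: with d about n/p, each pass recovers the neighbourhoods of all nodes of degree
at most d, so the search advances for free until it meets a layer with a node of larger degree. Such
a layer costs one pass, and there are at most 3n/(d+1) of them (`card_highLayers_mul_le`,
`step_knownDist`).

Randomized part: take h about p/8, the source and about (n/p) log n random starting nodes, and run a
breadth-first search from each for 2h passes, after a random delay below h. With high probability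
every shortest path longer than h has a starting node among the h nodes before its end. The delays
spread the layers of the searches, so that the pairs (search, node) reached at any one time number
about (n/p)^2 up to logarithms (`le_card_goodSeed`), and sparse recovery finds the next frontier
(`FindsBFSTree.sweep`). A first sweep records distances between starting nodes, which give their
distances from the source; a second one keeps, for each node, the best length through a starting
node. Tables of K^2, n and M entries all fit because p ≤ √n gives n ≤ (n/p)^2. -/

namespace GraphStream

open Finset

/-! ### Linear queries -/

section Query

variable {n : ℕ}

open Classical in
/-- The sum of `f` over the edges of `G`. -/
noncomputable def edgeSum {A : Type*} [AddCommMonoid A] (G : SimpleGraph (Fin n))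
    (f : Sym2 (Fin n) → A) : A :=
  ∑ e : Sym2 (Fin n) with e ∈ G.edgeSet, f e

lemma edgeSum_map {A B : Type*} [AddCommMonoid A] [AddCommMonoid B] (G : SimpleGraph (Fin n))
    (f : Sym2 (Fin n) → A) (φ : A →+ B) : edgeSum G (fun e => φ (f e)) = φ (edgeSum G f) := by
  simp [edgeSum, map_sum]

lemma edgeSum_apply {κ : Type*} {A : Type*} [AddCommMonoid A] (G : SimpleGraph (Fin n))
    (f : Sym2 (Fin n) → κ → A) (k : κ) : edgeSum G f k = edgeSum G (fun e => f e k) := by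
  simp [edgeSum]

lemma edgeSum_prod {A B : Type*} [AddCommMonoid A] [AddCommMonoid B] (G : SimpleGraph (Fin n))
    (f : Sym2 (Fin n) → A) (f' : Sym2 (Fin n) → B) :
    edgeSum G (fun e => (f e, f' e)) = (edgeSum G f, edgeSum G f') := by
  ext <;> simp [edgeSum, Prod.fst_sum, Prod.snd_sum]

/-- A stream determines the sum of `f` over the edges of its graph. -/
lemma IsTurnstileStream.sum_eq {A : Type*} [AddCommGroup A] {G : SimpleGraph (Fin n)}
    {σ : List (Update n)} (hσ : IsTurnstileStream G σ) (f : Sym2 (Fin n) → A) :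
    (σ.map fun u => u.sign • f u.edge).sum = edgeSum G f := by
  classical
  have key : ∀ τ : List (Update n),
      (τ.map fun u => u.sign • f u.edge).sum = ∑ e, netCount τ e • f e := by
    intro τ
    induction τ with
    | nil => simp [netCount]
    | cons u τ ih =>
      have : ∀ e, netCount (u :: τ) e = (if u.edge = e then u.sign else 0) + netCount τ e := by
        intro e; simp [netCount]
      simp only [List.map_cons, List.sum_cons, ih, this, add_smul, Finset.sum_add_distrib]
      simp [ite_smul]
  rw [key, edgeSum, Finset.sum_filter]
  refine Finset.sum_congr rfl fun e _ => ?_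
  split_ifs with h
  · rw [hσ.final_mem e h, one_smul]
  · rw [hσ.final_notMem e h, zero_smul]

open Classical in
/-- The contribution of the edge `e` to the number of neighbours of `v` that satisfy `P`. -/
noncomputable def nbrQuery (R : Type*) [Semiring R] (v : Fin n) (P : Fin n → Prop)
    (e : Sym2 (Fin n)) : R :=
  if ∃ u, e = s(u, v) ∧ P u then 1 else 0

open Classical in
lemma edgeSum_nbrQuery (R : Type*) [Semiring R] (G : SimpleGraph (Fin n)) (v : Fin n)
    (P : Fin n → Prop) :
    edgeSum G (nbrQuery R v P) = ((#{u | G.Adj u v ∧ P u} : ℕ) : R) := by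
  unfold edgeSum nbrQuery
  rw [← Finset.sum_filter_add_sum_filter_not _ (fun e => ∃ u, e = s(u, v) ∧ P u)]
  rw [Finset.sum_congr rfl (g := fun _ => (1 : R)), Finset.sum_congr (s₁ := filter (fun e => ¬ _) _) rfl
    (g := fun _ => (0 : R))]
  · simp only [Finset.sum_const_zero, add_zero, Finset.sum_const, nsmul_eq_mul, mul_one]
    congr 1
    symm
    refine Finset.card_bij (fun u _ => s(u, v)) ?_ ?_ ?_
    · intro u hu
      simp only [mem_filter, mem_univ, true_and] at hu ⊢
      exact ⟨hu.1, u, rfl, hu.2⟩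
    · intro u hu w hw h
      simp only [mem_filter, mem_univ, true_and] at hu hw
      rcases Sym2.eq_iff.1 h with h | h
      · exact h.1
      · exact h.1.trans h.2
    · intro e he
      simp only [mem_filter, mem_univ, true_and] at he
      obtain ⟨h1, u, rfl, hu⟩ := he
      exact ⟨u, by simpa using ⟨h1, hu⟩, rfl⟩
  · intro e he
    simp only [mem_filter, mem_univ, true_and] at he
    rw [if_neg he.2]
  · intro e he
    simp only [mem_filter, mem_univ, true_and] at he
    rw [if_pos he.2]

/-- Counts of nodes are at most n, so a prime modulus above n loses nothing, while the answers live
in a field and take about log n bits each. -/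
lemma card_nbr_eq_of_cast_eq {q : ℕ} (hq : n < q) {s t : Finset (Fin n)}
    (h : ((#s : ℕ) : ZMod q) = ((#t : ℕ) : ZMod q)) : #s = #t := by
  rw [ZMod.natCast_eq_natCast_iff'] at h
  have h1 : #s ≤ n := by simpa using card_le_univ s
  have h2 : #t ≤ n := by simpa using card_le_univ t
  rwa [Nat.mod_eq_of_lt (by omega), Nat.mod_eq_of_lt (by omega)] at h

end Query

/-! ### Multi-pass algorithms given by linear queries -/

section Passes

variable {n : ℕ} {I : Type} {α β : Type}

/-- On the instances `i : I` with graphs `g i`, the information `Y i` is determined by `X i` and the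
answer to a linear query that depends on `X i`; the number of pairs of a state and an answer is at
most `N`. -/
def Step (g : I → SimpleGraph (Fin n)) (N : ℕ) [Fintype α] (X : I → α) (Y : I → β) : Prop :=
  ∃ (A : Type) (_ : AddCommGroup A) (_ : Fintype A) (f : α → Sym2 (Fin n) → A),
    Fintype.card α * Fintype.card A ≤ N ∧
      ∀ i j, X i = X j → edgeSum (g i) (f (X i)) = edgeSum (g j) (f (X j)) → Y i = Y j

/-- From the information `X i`, a deterministic algorithm with `p` passes and `N` memory states
finds a BFS tree of `g i` rooted at `src i`, on every turnstile stream of `g i`. -/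
def FindsBFSTree (g : I → SimpleGraph (Fin n)) (src : I → Fin n) (p N : ℕ) (X : I → α) : Prop :=
  ∃ (M : Type) (_ : Fintype M) (init : α → M) (upd : M → Update n → M) (fin : M → M)
    (out : M → SimpleGraph (Fin n)), Fintype.card M ≤ N ∧
      ∀ i σ, IsTurnstileStream (g i) σ →
        IsBFSTree (g i) (src i) (out ((fun m => fin (σ.foldl upd m))^[p] (init (X i))))

variable {g : I → SimpleGraph (Fin n)} {src : I → Fin n}

lemma FindsBFSTree.of_output [Fintype α] (X : I → α) (out : α → SimpleGraph (Fin n))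
    (h : ∀ i, IsBFSTree (g i) (src i) (out (X i))) :
    FindsBFSTree g src 0 (Fintype.card α) X :=
  ⟨α, inferInstance, id, fun m _ => m, id, out, le_rfl, fun i _ _ => h i⟩

lemma FindsBFSTree.mono {p N N' : ℕ} {X : I → α} (h : FindsBFSTree g src p N X) (hN : N ≤ N') :
    FindsBFSTree g src p N' X := by
  obtain ⟨M, _, init, upd, fin, out, hM, h⟩ := h
  exact ⟨M, inferInstance, init, upd, fin, out, hM.trans hN, h⟩

lemma FindsBFSTree.comp {p N : ℕ} {X : I → α} {f : β → α} {Y : I → β}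
    (h : FindsBFSTree g src p N X) (hf : ∀ i, f (Y i) = X i) : FindsBFSTree g src p N Y := by
  obtain ⟨M, _, init, upd, fin, out, hM, h⟩ := h
  exact ⟨M, inferInstance, init ∘ f, upd, fin, out, hM, fun i σ hσ => by
    simpa [hf] using h i σ hσ⟩

/-- Information that is determined by other information may be replaced by it. -/
lemma FindsBFSTree.of_determined [Nonempty α] {p N : ℕ} {X : I → α} {Y : I → β}
    (h : FindsBFSTree g src p N X) (hf : ∀ i j, Y i = Y j → X i = X j) :
    FindsBFSTree g src p N Y :=
  h.comp (f := Function.extend Y X fun _ => Classical.arbitrary α) fun _ =>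
    Function.FactorsThrough.extend_apply (fun _ _ h => hf _ _ h) _ _

/-- Opens a new stage: the initial value of its register is a function of what is already in memory.
-/
lemma FindsBFSTree.of_snd_determined [Nonempty β] {p N : ℕ} {X : I → α} {Y : I → β}
    (h : FindsBFSTree g src p N fun i => (X i, Y i)) (hf : ∀ i j, X i = X j → Y i = Y j) :
    FindsBFSTree g src p N X :=
  h.comp (f := fun a => (a, Function.extend X Y (fun _ => Classical.arbitrary β) a)) fun i =>
    Prod.ext rfl (Function.FactorsThrough.extend_apply (f := X) (g := Y) (fun _ _ h => hf _ _ h)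
      (fun _ => Classical.arbitrary β) i)

/-- During the first pass the memory holds the old knowledge and a partial sum; at its end it
switches to the states of the remaining algorithm. The two kinds of state form a disjoint union, so
their numbers add. -/
lemma Step.cons [Fintype α] {p N N' : ℕ} {X : I → α} {Y : I → β} (h : Step g N X Y)
    (hY : FindsBFSTree g src p N' Y) : FindsBFSTree g src (p + 1) (N + N') X := by
  classical
  obtain ⟨A, _, _, f, hA, hf⟩ := h
  obtain ⟨M, _, init, upd, fin, out, hM, h⟩ := hY
  -- Any instance consistent with the knowledge and the answer may be chosen, since all of them have
  -- the same `Y`.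
  let next : α × A → α × A ⊕ M := fun z =>
    if hz : ∃ i, X i = z.1 ∧ edgeSum (g i) (f (X i)) = z.2 then .inr (init (Y hz.choose)) else .inl z
  have hnext : ∀ i, next (X i, edgeSum (g i) (f (X i))) = .inr (init (Y i)) := by
    intro i
    have hz : ∃ j, X j = X i ∧ edgeSum (g j) (f (X j)) = edgeSum (g i) (f (X i)) := ⟨i, rfl, rfl⟩
    simp only [next, dif_pos hz]
    rw [hf _ _ hz.choose_spec.1 hz.choose_spec.2]
  let upd' : α × A ⊕ M → Update n → α × A ⊕ M := fun m u =>
    m.elim (fun z => .inl (z.1, z.2 + u.sign • f z.1 u.edge)) fun m => .inr (upd m u)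
  have hinr : ∀ σ m, List.foldl upd' (.inr m) σ = .inr (List.foldl upd m σ) := by
    intro σ
    induction σ with
    | nil => intro m; rfl
    | cons u σ ih => intro m; exact ih _
  have hinl : ∀ (σ : List (Update n)) a z, List.foldl upd' (.inl (a, z)) σ
      = .inl (a, z + (σ.map fun u => u.sign • f a u.edge).sum) := by
    intro σ
    induction σ with
    | nil => intro a z; simp
    | cons u σ ih =>
      intro a z
      rw [List.foldl_cons]
      refine (ih _ _).trans ?_
      simp [add_assoc]
  let fin' : α × A ⊕ M → α × A ⊕ M := fun m => m.elim next fun m => .inr (fin m)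
  refine ⟨α × A ⊕ M, inferInstance, fun a => .inl (a, 0), upd', fin',
    fun m => m.elim (fun _ => ⊥) out, by simp; omega, fun i σ hσ => ?_⟩
  have hpass : ∀ k m, (fun m => fin' (σ.foldl upd' m))^[k] (.inr m)
      = .inr ((fun m => fin (σ.foldl upd m))^[k] m) := by
    intro k
    induction k with
    | zero => intro m; rfl
    | succ k ih =>
      intro m
      simp only [Function.iterate_succ_apply, hinr, fin', Sum.elim_inr]
      exact ih _
  rw [Function.iterate_succ_apply]
  simp only [hinl, zero_add, hσ.sum_eq]
  have : fin' (.inl (X i, edgeSum (g i) (f (X i)))) = .inr (init (Y i)) := by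
    simpa [fin'] using hnext i
  rw [this, hpass]
  exact h i σ hσ

lemma FindsBFSTree.of_steps [Fintype α] {p N N' : ℕ} (X : ℕ → I → α) (T : ℕ)
    (hX : ∀ t < T, Step g N (X t) (X (t + 1))) (hT : FindsBFSTree g src p N' (X T)) :
    FindsBFSTree g src (T + p) (T * N + N') (X 0) := by
  induction T generalizing X with
  | zero => simpa using hT
  | succ T ih =>
    have h1 := ih (fun t => X (t + 1)) (fun t ht => hX (t + 1) (by omega)) hT
    have h2 := (hX 0 (by omega)).cons h1
    convert h2 using 1 <;> ring

lemma Step.refl [Fintype α] (X : I → α) : Step g (Fintype.card α) X X :=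
  ⟨Unit, inferInstance, inferInstance, fun _ _ => (), by simp, fun _ _ h _ => h⟩

/-- Passes may be wasted. -/
lemma FindsBFSTree.idle [Fintype α] {p p' N : ℕ} {X : I → α} (h : FindsBFSTree g src p N X)
    (hp : p ≤ p') :
    FindsBFSTree g src p' ((p' - p) * Fintype.card α + N) X := by
  have := FindsBFSTree.of_steps (fun _ => X) (p' - p) (fun _ _ => Step.refl X) h
  rwa [Nat.sub_add_cancel hp] at this

end Passes

/-! ### Bits of memory -/

section Encoding

variable {n : ℕ}

lemma exists_injective_memory {M : Type} [Fintype M] {S : ℕ} (h : Fintype.card M ≤ 2 ^ S) :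
    ∃ e : M → Memory S, Function.Injective e := by
  have : Fintype.card M ≤ Fintype.card (Memory S) := by simpa using h
  obtain ⟨e⟩ := Function.Embedding.nonempty_of_card_le this
  exact ⟨e, e.injective⟩

/-- Decoding, updating and encoding again simulates an algorithm on abstract states; bit strings
outside the image are never reached. -/
lemma foldl_invFun {M R α : Type*} [Nonempty M] {e : M → R} (he : Function.Injective e)
    (upd : M → α → M) (σ : List α) (m : M) :
    σ.foldl (fun b a => e (upd (Function.invFun e b) a)) (e m) = e (σ.foldl upd m) := by
  induction σ generalizing m with
  | nil => rfl
  | cons a σ ih => simp only [List.foldl_cons, Function.leftInverse_invFun he m, ih]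

lemma iterate_invFun {M R α : Type*} [Nonempty M] {e : M → R} (he : Function.Injective e)
    (upd : M → α → M) (fin : M → M) (σ : List α) (p : ℕ) (m : M) :
    (fun b => e (fin (Function.invFun e
      (σ.foldl (fun b a => e (upd (Function.invFun e b) a)) b))))^[p] (e m)
      = e ((fun m => fin (σ.foldl upd m))^[p] m) := by
  induction p generalizing m with
  | zero => rfl
  | succ p ih =>
    simp only [Function.iterate_succ_apply, foldl_invFun he, Function.leftInverse_invFun he _, ih]

/-- The turnstile stream that corresponds to an insertion-only stream. -/
lemma IsInsertionStream.isTurnstileStream {G : SimpleGraph (Fin n)} {σ : List (Sym2 (Fin n))}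
    (h : IsInsertionStream G σ) : IsTurnstileStream G (σ.map Update.insert) := by
  have key : ∀ τ : List (Sym2 (Fin n)), ∀ e, netCount (τ.map Update.insert) e = τ.count e := by
    intro τ e
    induction τ with
    | nil => simp [netCount]
    | cons a τ ih =>
      have : netCount ((a :: τ).map Update.insert) e
          = (if a = e then 1 else 0) + netCount (τ.map Update.insert) e := by
        simp only [netCount, List.map_cons, List.sum_cons, Update.edge, Update.sign]
        congr
      rw [this, ih, List.count_cons]
      by_cases hae : a = e <;> simp [hae, add_comm]
  refine ⟨?_, ?_, ?_, ?_⟩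
  · intro u hu
    obtain ⟨e, he, rfl⟩ := List.mem_map.1 hu
    exact G.not_isDiag_of_mem_edgeSet ((h.2 e).1 he)
  · intro τ hτ e
    obtain ⟨τ', -, rfl⟩ := List.prefix_map_iff.1 hτ
    rw [key]; positivity
  · intro e he
    rw [key, List.count_eq_one_of_mem h.1 ((h.2 e).2 he)]; rfl
  · intro e he
    rw [key, List.count_eq_zero_of_not_mem fun h' => he ((h.2 e).1 h')]; rfl

/-- Connected graphs on `n` nodes with a source node. -/
abbrev RootedGraph (n : ℕ) : Type := Fin n × {G : SimpleGraph (Fin n) // G.Connected}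

lemma FindsBFSTree.exists_detAlgorithm (hn : 0 < n) {p N S : ℕ} (hS : N ≤ 2 ^ S)
    (h : FindsBFSTree (I := RootedGraph n) (fun i => i.2.1) (fun i => i.1) p N (fun i => i.1)) :
    ∃ A : DetAlgorithm n S (Update n), ∀ G : SimpleGraph (Fin n), G.Connected → ∀ s σ,
      IsTurnstileStream G σ → IsBFSTree G s (A.run p s σ) := by
  obtain ⟨M, _, init, upd, fin, out, hM, h⟩ := h
  have : Nonempty M := ⟨init ⟨0, hn⟩⟩
  obtain ⟨e, he⟩ := exists_injective_memory (hM.trans hS)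
  refine ⟨⟨fun s => e (init s), fun b a => e (upd (Function.invFun e b) a),
    fun b => e (fin (Function.invFun e b)), fun b => out (Function.invFun e b)⟩, fun G hG s σ hσ => ?_⟩
  have := h (s, ⟨G, hG⟩) σ hσ
  convert this using 1
  have h2 := iterate_invFun he upd fin σ p (init s)
  simp only [DetAlgorithm.run]
  refine congrArg out ?_
  refine (congrArg (Function.invFun e) ?_).trans (Function.leftInverse_invFun he _)
  exact h2

/-- Insertion-only streams are turnstile streams. -/
def DetAlgorithm.ofTurnstile {S : ℕ} (A : DetAlgorithm n S (Update n)) :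
    DetAlgorithm n S (Sym2 (Fin n)) :=
  ⟨A.init, fun m e => A.update m (.insert e), A.endPass, A.output⟩

lemma DetAlgorithm.run_ofTurnstile {S : ℕ} (A : DetAlgorithm n S (Update n)) (p : ℕ) (s : Fin n)
    (σ : List (Sym2 (Fin n))) : A.ofTurnstile.run p s σ = A.run p s (σ.map .insert) := by
  have : A.ofTurnstile.pass σ = A.pass (σ.map .insert) := by
    funext m
    simp [pass, ofTurnstile, List.foldl_map]
  rw [run, run, this]
  rfl

/-- A randomized algorithm that tosses all its coins at the beginning. -/
noncomputable def RandAlgorithm.ofInit {S r : ℕ} (A : DetAlgorithm n S (Update n))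
    (init : Fin n → (Fin r → Bool) → Memory S) : RandAlgorithm n S (Update n) :=
  ⟨r, init, fun m a _ => A.update m a, fun m _ => A.endPass m, A.output⟩

lemma RandAlgorithm.run_ofInit {S r : ℕ} (A : DetAlgorithm n S (Update n))
    (init : Fin n → (Fin r → Bool) → Memory S) (p : ℕ) (s : Fin n) (σ : List (Update n)) :
    (RandAlgorithm.ofInit A init).run p s σ
      = (tosses r).map fun ω => A.output ((A.pass σ)^[p] (init s ω)) := by
  have hpass : ∀ (σ : List (Update n)) m,
      (RandAlgorithm.ofInit A init).pass σ m = PMF.pure (A.pass σ m) := by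
    intro σ
    induction σ with
    | nil => intro m; exact PMF.map_const _ _
    | cons a σ ih =>
      intro m
      have : (tosses (RandAlgorithm.ofInit A init).coins).map
          ((RandAlgorithm.ofInit A init).update m a) = PMF.pure (A.update m a) :=
        PMF.map_const _ _
      rw [RandAlgorithm.pass, this, PMF.pure_bind, ih]
      rfl
  have hlaw : ∀ p, (RandAlgorithm.ofInit A init).memoryLaw s σ p
      = (tosses r).map fun ω => (A.pass σ)^[p] (init s ω) := by
    intro p
    induction p with
    | zero => rfl
    | succ p ih =>
      rw [RandAlgorithm.memoryLaw, ih, funext (hpass σ)]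
      refine (PMF.bind_pure_comp (A.pass σ) _).trans ?_
      rw [PMF.map_comp]
      congr 1
      funext ω
      simp [Function.iterate_succ_apply']
  rw [RandAlgorithm.run, hlaw, PMF.map_comp]
  rfl

/-- Connected graphs with a source node and a good outcome of the coins. -/
abbrev SeededGraph (n r : ℕ) (good : (Fin r → Bool) → RootedGraph n → Prop) : Type :=
  {i : (Fin r → Bool) × RootedGraph n // good i.1 i.2}

-- The seed belongs to the initial knowledge, hence is paid for in memory. Correctness is required
-- only on pairs of a seed and a graph that fit, so the success probability is at least the fraction
-- of good seeds.
open Classical in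
lemma FindsBFSTree.exists_randAlgorithm (hn : 0 < n) {p N S r : ℕ} (hS : N ≤ 2 ^ S)
    (good : (Fin r → Bool) → RootedGraph n → Prop)
    (h : FindsBFSTree (I := SeededGraph n r good) (fun i => i.1.2.2.1) (fun i => i.1.2.1) p N
      (fun i => (i.1.2.1, i.1.1))) :
    ∃ A : RandAlgorithm n S (Update n), ∀ G : SimpleGraph (Fin n), ∀ (hG : G.Connected), ∀ s σ,
      IsTurnstileStream G σ →
        (#{ω | good ω (s, ⟨G, hG⟩)} : ℝ) / 2 ^ r ≤
          ((A.run p s σ).toOuterMeasure {T | IsBFSTree G s T}).toReal := by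
  obtain ⟨M, _, init, upd, fin, out, hM, h⟩ := h
  have : Nonempty M := ⟨init (⟨0, hn⟩, fun _ => false)⟩
  obtain ⟨e, he⟩ := exists_injective_memory (hM.trans hS)
  refine ⟨RandAlgorithm.ofInit ⟨fun s => e (init (s, fun _ => false)),
    fun b a => e (upd (Function.invFun e b) a),
    fun b => e (fin (Function.invFun e b)), fun b => out (Function.invFun e b)⟩
    (fun s ω => e (init (s, ω))), fun G hG s σ hσ => ?_⟩
  rw [RandAlgorithm.run_ofInit, PMF.toOuterMeasure_map_apply, tosses,
    PMF.toOuterMeasure_uniformOfFintype_apply]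
  simp only [Fintype.card_fun, Fintype.card_bool, Fintype.card_fin, ENNReal.toReal_div,
    ENNReal.toReal_natCast]
  push_cast
  gcongr
  rw [← Set.toFinset_card]
  refine Finset.card_le_card fun ω hω => ?_
  simp only [mem_filter, mem_univ, true_and] at hω
  simp only [Set.mem_toFinset, Set.mem_preimage, Set.mem_ofPred_eq]
  have := h ⟨(ω, s, ⟨G, hG⟩), hω⟩ σ hσ
  convert this using 1
  have h2 := iterate_invFun he upd fin σ p (init (s, ω))
  refine congrArg out ?_
  refine (congrArg (Function.invFun e) ?_).trans (Function.leftInverse_invFun he _)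
  exact h2

end Encoding

/-! ### Distances and BFS trees -/

section Distances

variable {n : ℕ} {G : SimpleGraph (Fin n)}

lemma dist_le_dist_add_one (hG : G.Connected) {u v : Fin n} (h : G.Adj u v) (s : Fin n) :
    G.dist s v ≤ G.dist s u + 1 := by
  have := hG.dist_triangle (u := s) (v := u) (w := v)
  rwa [SimpleGraph.dist_eq_one_iff_adj.2 h] at this

lemma exists_dist_add_dist_eq (hG : G.Connected) {s v : Fin n} {k : ℕ} (hk : k ≤ G.dist s v) :
    ∃ u, G.dist s u = k ∧ G.dist s u + G.dist u v = G.dist s v := by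
  obtain ⟨w, hw⟩ := hG.exists_walk_length_eq_dist s v
  refine ⟨w.getVert k, ?_⟩
  have h1 := SimpleGraph.dist_le (w.take k)
  have h2 := SimpleGraph.dist_le (w.drop k)
  have h3 := hG.dist_triangle (u := s) (v := w.getVert k) (w := v)
  rw [SimpleGraph.Walk.take_length] at h1
  rw [SimpleGraph.Walk.drop_length] at h2
  omega

lemma exists_adj_dist_eq (hG : G.Connected) {s v : Fin n} {k : ℕ} (hk : G.dist s v = k + 1) :
    ∃ u, G.Adj u v ∧ G.dist s u = k := by
  obtain ⟨u, h1, h2⟩ := exists_dist_add_dist_eq hG (s := s) (v := v) (k := k) (by omega)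
  exact ⟨u, SimpleGraph.dist_eq_one_iff_adj.1 (by omega), h1⟩

lemma dist_lt_card (hG : G.Connected) (s v : Fin n) : G.dist s v < n := by
  obtain ⟨w, hw, hl⟩ := hG.exists_path_of_dist s v
  rw [← hl]
  simpa using hw.length_lt

/-- The tree in which every node other than the root `s` is joined to its parent. -/
def parentTree (s : Fin n) (par : Fin n → Fin n) : SimpleGraph (Fin n) :=
  SimpleGraph.fromEdgeSet {e | ∃ v, v ≠ s ∧ e = s(par v, v)}

lemma isBFSTree_parentTree (hG : G.Connected) {s : Fin n} {par : Fin n → Fin n}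
    (hpar : ∀ v, v ≠ s → G.Adj (par v) v ∧ G.dist s (par v) + 1 = G.dist s v) :
    IsBFSTree G s (parentTree s par) := by
  have hle : parentTree s par ≤ G := by
    intro u v h
    obtain ⟨⟨w, hw, he⟩, -⟩ := (SimpleGraph.fromEdgeSet_adj _).1 h
    have := (hpar w hw).1
    rwa [← SimpleGraph.mem_edgeSet, ← he] at this
  have hadj : ∀ v, v ≠ s → (parentTree s par).Adj (par v) v := fun v hv =>
    (SimpleGraph.fromEdgeSet_adj _).2 ⟨⟨v, hv, rfl⟩, (hpar v hv).1.ne⟩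
  have hwalk : ∀ k v, G.dist s v = k → ∃ w : (parentTree s par).Walk s v, w.length = k := by
    intro k
    induction k with
    | zero =>
      intro v hv
      obtain rfl := hG.dist_eq_zero_iff.1 hv
      exact ⟨.nil, rfl⟩
    | succ k ih =>
      intro v hv
      have hvs : v ≠ s := by rintro rfl; simp at hv
      obtain ⟨w, hw⟩ := ih (par v) (by have := (hpar v hvs).2; omega)
      exact ⟨w.concat (hadj v hvs), by simp [hw]⟩
  have hconn : (parentTree s par).Connected := by
    have : Nonempty (Fin n) := ⟨s⟩
    rw [SimpleGraph.connected_iff_exists_forall_reachable]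
    exact ⟨s, fun v => (hwalk _ v rfl).choose.reachable⟩
  refine ⟨hle, ?_, fun v => le_antisymm ?_ ?_⟩
  -- There is at most one edge per non-root node, and connectedness gives the reverse inequality for
  -- the number of edges.
  · rw [SimpleGraph.isTree_iff_connected_and_card]
    refine ⟨hconn, le_antisymm ?_ hconn.card_vert_le_card_edgeSet_add_one⟩
    have hsub : (parentTree s par).edgeSet ⊆
        ((univ.erase s).image fun v => s(par v, v) : Finset (Sym2 (Fin n))) := by
      intro e he
      rw [parentTree, SimpleGraph.edgeSet_fromEdgeSet] at he
      obtain ⟨⟨v, hv, rfl⟩, -⟩ := he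
      simp only [coe_image, Set.mem_image, mem_coe, mem_erase, mem_univ, and_true]
      exact ⟨v, hv, rfl⟩
    have h1 := Nat.card_mono (Finset.finite_toSet _) hsub
    rw [Nat.card_eq_card_finite_toFinset (Finset.finite_toSet _), Finset.finite_toSet_toFinset] at h1
    have h2 := h1.trans card_image_le
    rw [card_erase_of_mem (mem_univ s)] at h2
    simp only [card_univ, Fintype.card_fin, Nat.card_eq_fintype_card] at h2 ⊢
    have := s.pos
    omega
  · obtain ⟨w, hw⟩ := hwalk _ v rfl
    exact hw ▸ SimpleGraph.dist_le w
  · exact SimpleGraph.Reachable.dist_anti hle (hconn.preconnected s v)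

lemma exists_isBFSTree (hG : G.Connected) (s : Fin n) : ∃ T, IsBFSTree G s T := by
  have : ∀ v, ∃ u, v ≠ s → G.Adj u v ∧ G.dist s u + 1 = G.dist s v := by
    intro v
    by_cases hv : v = s
    · exact ⟨v, fun h => absurd hv h⟩
    · obtain ⟨k, hk⟩ := Nat.exists_eq_succ_of_ne_zero (hG.pos_dist_of_ne (Ne.symm hv)).ne'
      obtain ⟨u, h1, h2⟩ := exists_adj_dist_eq hG hk
      exact ⟨u, fun _ => ⟨h1, by omega⟩⟩
  choose par hpar using this
  exact ⟨_, isBFSTree_parentTree hG hpar⟩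

open Classical in
/-- The first of the neighbours of `v` that are one step closer to `s`; and `s` itself if `v = s`. -/
noncomputable def firstParent (G : SimpleGraph (Fin n)) (s v : Fin n) : Fin n :=
  if h : v ≠ s ∧ ∃ u, G.Adj u v ∧ G.dist s u + 1 = G.dist s v then Fin.find _ h.2 else s

lemma firstParent_self (G : SimpleGraph (Fin n)) (s : Fin n) : firstParent G s s = s := by
  simp [firstParent]

lemma firstParent_spec (hG : G.Connected) {s v : Fin n} (hv : v ≠ s) :
    (G.Adj (firstParent G s v) v ∧ G.dist s (firstParent G s v) + 1 = G.dist s v) ∧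
      ∀ u, G.Adj u v → G.dist s u + 1 = G.dist s v → firstParent G s v ≤ u := by
  classical
  have h : v ≠ s ∧ ∃ u, G.Adj u v ∧ G.dist s u + 1 = G.dist s v := by
    refine ⟨hv, ?_⟩
    obtain ⟨k, hk⟩ := Nat.exists_eq_succ_of_ne_zero (hG.pos_dist_of_ne (Ne.symm hv)).ne'
    obtain ⟨u, h1, h2⟩ := exists_adj_dist_eq hG hk
    exact ⟨u, h1, by omega⟩
  rw [firstParent, dif_pos h]
  exact ⟨Fin.find_spec h.2, fun u h1 h2 => Fin.find_le_of_pos _ ⟨h1, h2⟩⟩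

end Distances

/-! ### Reading off the parents -/

section Parents

variable {n : ℕ} {I : Type} {g : I → SimpleGraph (Fin n)} {src : I → Fin n}

/-- Once the distances are known, the source and the distances. -/
noncomputable def distInfo (hg : ∀ i, (g i).Connected) (src : I → Fin n) (i : I) :
    Fin n × (Fin n → Fin n) :=
  (src i, fun v => ⟨(g i).dist (src i) v, dist_lt_card (hg i) _ _⟩)

/-- Parents are found by binary search when the distances are known. -/
lemma findsBFSTree_of_dist (hn : 0 < n) (hg : ∀ i, (g i).Connected) {ℓ q : ℕ} (hℓ : n ≤ 2 ^ ℓ) (hq : n < q) :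
    FindsBFSTree g src ℓ ((ℓ * q ^ n + 1) * (n * n ^ n * n ^ n)) (distInfo hg src) := by
  classical
  have : NeZero q := ⟨by omega⟩
  let par : I → Fin n → Fin n := fun i => firstParent (g i) (src i)
  -- At stage t the t leading ones of the ℓ bits of every parent are known.
  let X : ℕ → I → (Fin n × (Fin n → Fin n)) × (Fin n → Fin n) := fun t i =>
    (distInfo hg src i, fun v => ⟨par i v / 2 ^ (ℓ - t), (Nat.div_le_self _ _).trans_lt (par i v).2⟩)
  have hdist : ∀ {t i j}, X t i = X t j → src i = src j ∧
      (∀ v, (g i).dist (src i) v = (g j).dist (src j) v) ∧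
      ∀ v, (par i v : ℕ) / 2 ^ (ℓ - t) = par j v / 2 ^ (ℓ - t) := by
    intro t i j h
    simp only [X, distInfo, Prod.mk.injEq, funext_iff, Fin.mk.injEq] at h
    exact ⟨h.1.1, h.1.2, h.2⟩
  have hstep : ∀ t < ℓ, Step g (n * n ^ n * n ^ n * q ^ n) (X t) (X (t + 1)) := by
    intro t ht
    refine ⟨Fin n → ZMod q, inferInstance, inferInstance, fun x e v => nbrQuery (ZMod q) v
      (fun u => (x.1.2 u : ℕ) + 1 = x.1.2 v ∧ (u : ℕ) / 2 ^ (ℓ - (t + 1)) = 2 * x.2 v) e,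
      by simp [ZMod.card], fun i j h hA => ?_⟩
    obtain ⟨hsrc, hd, hp⟩ := hdist h
    suffices hs : ∀ v, (par i v : ℕ) / 2 ^ (ℓ - (t + 1)) = par j v / 2 ^ (ℓ - (t + 1)) by
      simp only [X, distInfo, Prod.mk.injEq, funext_iff, Fin.mk.injEq]
      exact ⟨⟨hsrc, hd⟩, hs⟩
    intro v
    by_cases hv : v = src i
    · have h1 : par i v = src i := by rw [hv]; exact firstParent_self _ _
      have h2 : par j v = src j := by rw [hv, hsrc]; exact firstParent_self _ _
      rw [h1, h2, hsrc]
    have hpow : 2 ^ (ℓ - t) = 2 ^ (ℓ - (t + 1)) * 2 := by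
      rw [← pow_succ]; congr 1; omega
    set m := 2 ^ (ℓ - (t + 1)) with hm
    have hcount := congrFun hA v
    rw [edgeSum_apply, edgeSum_apply, edgeSum_nbrQuery, edgeSum_nbrQuery] at hcount
    replace hcount := card_nbr_eq_of_cast_eq hq hcount
    -- The parent is the least candidate, so its next bit is 0 exactly when some candidate has the
    -- known prefix followed by 0. An existence query therefore reveals the bit.
    have key : ∀ k, v ≠ src k → ((∃ u, (g k).Adj u v ∧ ((X t k).1.2 u : ℕ) + 1 = (X t k).1.2 v ∧
        (u : ℕ) / m = 2 * (X t k).2 v) ↔ (par k v : ℕ) / m = 2 * ((par k v : ℕ) / m / 2)) := by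
      intro k hk
      have hX : ((X t k).2 v : ℕ) = (par k v : ℕ) / m / 2 := by
        simp only [X, hpow, Nat.div_div_eq_div_mul]
      obtain ⟨⟨h1, h2⟩, h3⟩ := firstParent_spec (hg k) hk
      rw [hX]
      constructor
      · rintro ⟨u, hu, hdu, hum⟩
        have := h3 u hu (by simpa [X, distInfo] using hdu)
        have : (par k v : ℕ) / m ≤ u / m := Nat.div_le_div_right this
        omega
      · intro h
        exact ⟨par k v, h1, by simpa [X, distInfo] using h2, h⟩
    have hex : (∃ u, (g i).Adj u v ∧ ((X t i).1.2 u : ℕ) + 1 = (X t i).1.2 v ∧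
        (u : ℕ) / m = 2 * (X t i).2 v) ↔ ∃ u, (g j).Adj u v ∧ ((X t j).1.2 u : ℕ) + 1 = (X t j).1.2 v ∧
        (u : ℕ) / m = 2 * (X t j).2 v := by
      have := congrArg (0 < ·) hcount
      simpa only [card_pos, Finset.Nonempty, mem_filter, mem_univ, true_and, eq_iff_iff] using this
    rw [key i hv, key j (hsrc ▸ hv)] at hex
    have hpv := hp v
    rw [hpow, ← Nat.div_div_eq_div_mul, ← Nat.div_div_eq_div_mul] at hpv
    omega
  have hout : FindsBFSTree g src 0 (n * n ^ n * n ^ n) (X ℓ) := by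
    have := FindsBFSTree.of_output (g := g) (src := src) (X ℓ)
      (fun x => parentTree x.1.1 x.2) fun i => by
        have : (X ℓ i).2 = par i := by funext v; simp [X]
        rw [this]
        exact isBFSTree_parentTree (hg i) fun v hv => (firstParent_spec (hg i) hv).1
    simpa using this
  have h := FindsBFSTree.of_steps X ℓ hstep hout
  have h0 : FindsBFSTree g src ℓ ((ℓ * q ^ n + 1) * (n * n ^ n * n ^ n)) (X 0) := by
    convert h using 1 <;> ring
  have : Nonempty (Fin n) := ⟨⟨0, hn⟩⟩
  refine h0.of_determined fun i j hij => ?_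
  refine Prod.ext hij (funext fun v => Fin.ext ?_)
  simp [X, Nat.div_eq_of_lt ((par _ v).2.trans_le hℓ)]

end Parents

/-! ### Recovery of sparse vectors -/

section Sparse

open Polynomial in
/-- Power sums give a linear map to `ZMod q ^ (2 * s)` that is injective on the vectors with at most
`s` nonzero entries. -/
lemma exists_sparse_sketch {κ : Type*} [Fintype κ] {q : ℕ} [Fact q.Prime]
    (hκ : Fintype.card κ ≤ q) (s : ℕ) :
    ∃ Φ : (κ → ZMod q) →+ (Fin (2 * s) → ZMod q), ∀ (x y : κ → ZMod q) (S T : Finset κ),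
      (∀ k ∉ S, x k = 0) → (∀ k ∉ T, y k = 0) → #S ≤ s → #T ≤ s → Φ x = Φ y → x = y := by
  classical
  have : Fintype.card κ ≤ Fintype.card (ZMod q) := by rwa [ZMod.card]
  obtain ⟨a⟩ := Function.Embedding.nonempty_of_card_le this
  refine ⟨{ toFun := fun x i => ∑ k, a k ^ (i : ℕ) * x k, map_zero' := by ext; simp,
            map_add' := fun x y => by ext; simp [mul_add, sum_add_distrib] }, ?_⟩
  intro x y S T hx hy hS hT h
  have hz : ∀ i < 2 * s, ∑ k, a k ^ i * (x k - y k) = 0 := by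
    intro i hi
    have := congrFun h ⟨i, hi⟩
    simp only [AddMonoidHom.coe_mk, ZeroHom.coe_mk] at this
    simp [mul_sub, sum_sub_distrib, this]
  -- Vanishing power sums of `x - y` annihilate every polynomial of degree below 2s.
  have hp : ∀ p : (ZMod q)[X], p.natDegree < 2 * s → ∑ k, p.eval (a k) * (x k - y k) = 0 := by
    intro p hp
    simp only [eval_eq_sum_range' hp, sum_mul]
    rw [sum_comm]
    refine sum_eq_zero fun i hi => ?_
    simp only [mul_assoc, ← mul_sum]
    rw [hz i (mem_range.1 hi), mul_zero]
  funext k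
  by_cases hk : k ∈ S ∪ T
  · have hcard : #(S ∪ T) ≤ 2 * s := (card_union_le _ _).trans (by omega)
    -- This polynomial vanishes on the joint support except at `k`, so the sum isolates the entry at
    -- `k`.
    have hdeg : (∏ j ∈ (S ∪ T).erase k, (X - C (a j))).natDegree < 2 * s := by
      rw [natDegree_prod_of_monic _ _ fun j _ => monic_X_sub_C _]
      simp only [natDegree_X_sub_C, sum_const, smul_eq_mul, mul_one]
      have := card_erase_lt_of_mem hk
      omega
    have h0 := hp _ hdeg
    rw [Fintype.sum_eq_single k] at h0
    · rcases mul_eq_zero.1 h0 with h0 | h0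
      · rw [eval_prod, prod_eq_zero_iff] at h0
        obtain ⟨j, hj, hj'⟩ := h0
        rw [eval_sub, eval_X, eval_C, sub_eq_zero] at hj'
        exact absurd (a.injective hj').symm (mem_erase.1 hj).1
      · exact sub_eq_zero.1 h0
    · intro j hj
      by_cases hjST : j ∈ S ∪ T
      · rw [eval_prod, prod_eq_zero (mem_erase.2 ⟨hj, hjST⟩) (by simp), zero_mul]
      · rw [mem_union, not_or] at hjST
        rw [hx j hjST.1, hy j hjST.2, sub_zero, mul_zero]
  · rw [mem_union, not_or] at hk
    rw [hx k hk.1, hy k hk.2]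

/-- Lists of length M with blanks allowed cover all these sets. This is what makes a stored frontier
cost M logarithms instead of one bit per pair. -/
lemma card_small_finset_le (κ : Type*) [Fintype κ] (M : ℕ) :
    Fintype.card {s : Finset κ // #s ≤ M} ≤ (Fintype.card κ + 1) ^ M := by
  classical
  have : Function.Surjective (fun f : Fin M → Option κ =>
      (⟨univ.filter fun k => ∃ i, f i = some k, by
        refine (card_le_card_of_forall_subsingleton (t := univ) (fun k i => f i = some k) ?_ ?_).trans
          (by simp)
        · intro k hk
          obtain ⟨i, hi⟩ := (mem_filter.1 hk).2
          exact ⟨i, mem_univ _, hi⟩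
        · rintro i - k ⟨-, hk⟩ l ⟨-, hl⟩
          exact Option.some_injective _ (hk.symm.trans hl)⟩ : {s : Finset κ // #s ≤ M})) := by
    rintro ⟨s, hs⟩
    refine ⟨fun i => if h : (i : ℕ) < #s then some (s.equivFin.symm ⟨i, h⟩) else none,
      Subtype.ext ?_⟩
    ext k
    simp only [mem_filter, mem_univ, true_and]
    constructor
    · rintro ⟨i, hi⟩
      split_ifs at hi with h
      rw [Option.some_inj] at hi
      exact hi ▸ (s.equivFin.symm ⟨i, h⟩).2
    · intro hk
      refine ⟨⟨s.equivFin ⟨k, hk⟩, (s.equivFin ⟨k, hk⟩).2.trans_le hs⟩, ?_⟩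
      simp
  have := Fintype.card_le_of_surjective _ this
  simpa using this

variable {n : ℕ}

/-- The numbers of neighbours that satisfy a predicate, for several nodes and predicates. -/
noncomputable def nbrCounts (q : ℕ) {κ : Type*} (G : SimpleGraph (Fin n)) (v : κ → Fin n)
    (P : κ → Fin n → Prop) (k : κ) : ZMod q :=
  edgeSum G (nbrQuery (ZMod q) (v k) (P k))

/-- Linearity lets the sketch be accumulated edge by edge, so the long vector of counts is never
held in memory. -/
lemma edgeSum_sketch {κ A : Type*} {q : ℕ} [AddCommMonoid A] (Φ : (κ → ZMod q) →+ A)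
    (G : SimpleGraph (Fin n)) (v : κ → Fin n) (P : κ → Fin n → Prop) :
    edgeSum G (fun e => Φ fun k => nbrQuery (ZMod q) (v k) (P k) e) = Φ (nbrCounts q G v P) := by
  rw [edgeSum_map G (fun e k => nbrQuery (ZMod q) (v k) (P k) e) Φ]
  congr 1
  funext k
  rw [edgeSum_apply]
  rfl

lemma nbrCounts_eq_zero {κ : Type*} {q : ℕ} {G : SimpleGraph (Fin n)} {v : κ → Fin n}
    {P : κ → Fin n → Prop} {k : κ} (h : ∀ u, G.Adj u (v k) → ¬ P k u) :
    nbrCounts q G v P k = 0 := by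
  classical
  rw [nbrCounts, edgeSum_nbrQuery, filter_eq_empty_iff.2 fun u _ hu => h u hu.1 hu.2]
  simp

lemma exists_adj_iff_of_edgeSum_eq {q : ℕ} (hq : n < q) {G G' : SimpleGraph (Fin n)} {v : Fin n}
    {P P' : Fin n → Prop}
    (h : edgeSum G (nbrQuery (ZMod q) v P) = edgeSum G' (nbrQuery (ZMod q) v P')) :
    (∃ u, G.Adj u v ∧ P u) ↔ ∃ u, G'.Adj u v ∧ P' u := by
  classical
  rw [edgeSum_nbrQuery, edgeSum_nbrQuery] at h
  have := congrArg (0 < ·) (card_nbr_eq_of_cast_eq hq h)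
  simpa only [card_pos, Finset.Nonempty, mem_filter, mem_univ, true_and, eq_iff_iff] using this

end Sparse

/-! ### Layer by layer, with the edges at nodes of low degree for free -/

section Layers

variable {n : ℕ}

open Classical in
/-- The number of neighbours of `v`. -/
noncomputable def nbrNum (G : SimpleGraph (Fin n)) (v : Fin n) : ℕ := #{u | G.Adj u v}

open Classical in
/-- The layers below `r` of the BFS from `s` that contain a node of degree more than `d`. -/
noncomputable def highLayers (G : SimpleGraph (Fin n)) (s : Fin n) (d r : ℕ) : Finset ℕ :=
  {i ∈ range r | ∃ v, G.dist s v = i ∧ d < nbrNum G v}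

lemma highLayers_mono (G : SimpleGraph (Fin n)) (s : Fin n) (d : ℕ) {r r' : ℕ} (h : r ≤ r') :
    highLayers G s d r ⊆ highLayers G s d r' := by
  classical
  exact filter_subset_filter _ (range_subset_range.2 h)

/-- Double counting: pick a node of large degree in each such layer. A node has neighbours only in
its own layer and the two adjacent ones, so it is adjacent to at most three of the picked nodes. -/
lemma card_highLayers_mul_le {G : SimpleGraph (Fin n)} (hG : G.Connected) (s : Fin n) (d r : ℕ) :
    #(highLayers G s d r) * (d + 1) ≤ n * 3 := by
  classical
  have : ∀ i, ∃ v, i ∈ highLayers G s d r → G.dist s v = i ∧ d < nbrNum G v := by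
    intro i
    by_cases hi : i ∈ highLayers G s d r
    · exact (mem_filter.1 hi).2.imp fun v hv _ => hv
    · exact ⟨s, fun h => absurd h hi⟩
  choose v hv using this
  have := card_mul_le_card_mul (s := highLayers G s d r) (t := (univ : Finset (Fin n)))
    (m := d + 1) (n := 3) (fun i u => G.Adj u (v i)) ?_ ?_
  · simpa using this
  · intro i hi
    exact (hv i hi).2
  · intro u _
    have hsub : (highLayers G s d r).bipartiteBelow (fun i u => G.Adj u (v i)) u
        ⊆ Icc (G.dist s u - 1) (G.dist s u + 1) := by
      intro i hi
      obtain ⟨hi, hu⟩ := (mem_bipartiteBelow _).1 hi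
      have h1 := dist_le_dist_add_one hG hu s
      have h2 := dist_le_dist_add_one hG hu.symm s
      rw [(hv i hi).1] at h1 h2
      exact mem_Icc.2 ⟨by omega, h1⟩
    refine (card_le_card hsub).trans ?_
    rw [Nat.card_Icc]
    omega

open Classical in
/-- The distances from `s` of the nodes that are preceded by fewer than `t` layers with a node of
degree more than `d`. -/
noncomputable def knownDist (G : SimpleGraph (Fin n)) (hG : G.Connected) (s : Fin n) (d t : ℕ)
    (v : Fin n) : Option (Fin n) :=
  if #(highLayers G s d (G.dist s v)) < t then some ⟨G.dist s v, dist_lt_card hG s v⟩ else none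

variable {G G' : SimpleGraph (Fin n)} {s : Fin n} {d t : ℕ}

lemma knownDist_ne_none {hG : G.Connected} {v : Fin n} :
    knownDist G hG s d t v ≠ none ↔ #(highLayers G s d (G.dist s v)) < t := by
  simp [knownDist]

/-- Let `u` precede `v` on a shortest path. If `u` has low degree, its edge to `v` is shared by both
graphs. Otherwise layer r is high and `u` is known; then either `v` is known too, or exactly t high
layers lie below r + 1. In that case `v` has a known neighbour in `G'` as well, and known nodes of
`G'` lie at distance at most r. -/
lemma dist_succ_of_agree (hG : G.Connected) (hG' : G'.Connected)
    (hlow : ∀ v, nbrNum G v ≤ d → ∀ u, G.Adj u v ↔ G'.Adj u v)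
    (hknown : knownDist G hG s d t = knownDist G' hG' s d t)
    (hnbr : ∀ v, (∃ u, G.Adj u v ∧ knownDist G hG s d t u ≠ none) ↔
      ∃ u, G'.Adj u v ∧ knownDist G' hG' s d t u ≠ none)
    {r : ℕ} (hr : ∀ v, ∀ k ≤ r, G.dist s v = k ↔ G'.dist s v = k)
    (hh : highLayers G s d (r + 1) = highLayers G' s d (r + 1))
    (ht : #(highLayers G s d (r + 1)) ≤ t) {v : Fin n} (hv : G.dist s v = r + 1) :
    G'.dist s v = r + 1 := by
  classical
  have hgt : r < G'.dist s v := by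
    by_contra! h
    have := (hr v _ h).2 rfl
    omega
  suffices G'.dist s v ≤ r + 1 by omega
  obtain ⟨u, hu, hur⟩ := exists_adj_dist_eq hG hv
  have hur' := (hr u r le_rfl).1 hur
  by_cases hd : nbrNum G u ≤ d
  · have := dist_le_dist_add_one hG' ((hlow u hd v).1 hu.symm).symm s
    omega
  have hmem : r ∈ highLayers G s d (r + 1) :=
    mem_filter.2 ⟨mem_range.2 (by omega), u, hur, by omega⟩
  have hlt : #(highLayers G s d r) < #(highLayers G s d (r + 1)) := by
    refine card_lt_card ⟨highLayers_mono _ _ _ (by omega), fun h => ?_⟩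
    exact absurd (mem_range.1 (mem_filter.1 (h hmem)).1) (lt_irrefl r)
  have hku : knownDist G hG s d t u ≠ none := knownDist_ne_none.2 (by rw [hur]; omega)
  rcases ht.lt_or_eq with ht | ht
  · have hkv : knownDist G hG s d t v = some ⟨r + 1, hv ▸ dist_lt_card hG s v⟩ := by
      simp only [knownDist, hv, if_pos ht]
    rw [hknown, knownDist] at hkv
    split_ifs at hkv with h
    rw [Option.some_inj, Fin.mk.injEq] at hkv
    omega
  · obtain ⟨w, hw, hkw⟩ := (hnbr v).1 ⟨u, hu, hku⟩
    rw [knownDist_ne_none] at hkw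
    have : G'.dist s w < r + 1 := by
      by_contra! h
      have := card_le_card (highLayers_mono G' s d h)
      rw [← hh, ht] at this
      omega
    have := dist_le_dist_add_one hG' hw s
    omega

/-- The two conclusions need each other: distances up to r and equal degrees decide which layers
below r + 1 are high, and this feeds `dist_succ_of_agree`, applied in both directions. -/
lemma agree_of_card_highLayers_le (hG : G.Connected) (hG' : G'.Connected)
    (hlow : ∀ v, nbrNum G v ≤ d → ∀ u, G.Adj u v ↔ G'.Adj u v)
    (hdeg : ∀ v, nbrNum G v = nbrNum G' v)
    (hknown : knownDist G hG s d t = knownDist G' hG' s d t)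
    (hnbr : ∀ v, (∃ u, G.Adj u v ∧ knownDist G hG s d t u ≠ none) ↔
      ∃ u, G'.Adj u v ∧ knownDist G' hG' s d t u ≠ none)
    (r : ℕ) (ht : #(highLayers G s d r) ≤ t) :
    (∀ v, ∀ k ≤ r, G.dist s v = k ↔ G'.dist s v = k) ∧
      highLayers G s d r = highLayers G' s d r := by
  classical
  induction r with
  | zero =>
    refine ⟨fun v k hk => ?_, by simp [highLayers]⟩
    obtain rfl : k = 0 := by omega
    rw [hG.dist_eq_zero_iff, hG'.dist_eq_zero_iff]
  | succ r ih =>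
    obtain ⟨h1, h2⟩ := ih ((card_le_card (highLayers_mono G s d (by omega))).trans ht)
    have hh : highLayers G s d (r + 1) = highLayers G' s d (r + 1) := by
      ext i
      simp only [highLayers, mem_filter, mem_range, hdeg]
      refine and_congr_right fun hi => exists_congr fun v => and_congr_left' ?_
      exact h1 v i (by omega)
    refine ⟨fun v k hk => ?_, hh⟩
    rcases hk.lt_or_eq with hk | rfl
    · exact h1 v k (by omega)
    · exact ⟨dist_succ_of_agree hG hG' hlow hknown hnbr h1 hh ht,
        dist_succ_of_agree hG' hG (fun v hv u => (hlow v (hdeg v ▸ hv) u).symm) hknown.symm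
          (fun v => (hnbr v).symm) (fun v k hk => (h1 v k hk).symm) hh.symm (hh ▸ ht)⟩

lemma knownDist_succ_eq_of_agree (hG : G.Connected) (hG' : G'.Connected)
    (hlow : ∀ v, nbrNum G v ≤ d → ∀ u, G.Adj u v ↔ G'.Adj u v)
    (hdeg : ∀ v, nbrNum G v = nbrNum G' v)
    (hknown : knownDist G hG s d t = knownDist G' hG' s d t)
    (hnbr : ∀ v, (∃ u, G.Adj u v ∧ knownDist G hG s d t u ≠ none) ↔
      ∃ u, G'.Adj u v ∧ knownDist G' hG' s d t u ≠ none) :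
    knownDist G hG s d (t + 1) = knownDist G' hG' s d (t + 1) := by
  funext v
  by_cases h : #(highLayers G s d (G.dist s v)) ≤ t
  · obtain ⟨h1, h2⟩ := agree_of_card_highLayers_le hG hG' hlow hdeg hknown hnbr _ h
    have := (h1 v _ le_rfl).1 rfl
    simp only [knownDist, this, h2]
  by_cases h' : #(highLayers G' s d (G'.dist s v)) ≤ t
  · obtain ⟨h1, h2⟩ := agree_of_card_highLayers_le hG' hG
      (fun v hv u => (hlow v (hdeg v ▸ hv) u).symm) (fun v => (hdeg v).symm) hknown.symm
      (fun v => (hnbr v).symm) _ h'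
    have := (h1 v _ le_rfl).1 rfl
    simp only [knownDist, this, h2]
  · simp only [knownDist, Nat.lt_succ_iff, if_neg h, if_neg h']

variable {I : Type} {g : I → SimpleGraph (Fin n)} {src : I → Fin n}

/-- One pass asks for a d-sparse sketch of every neighbourhood, all degrees, and the number of known
neighbours of every node. The sketches are taken afresh in each pass and dropped afterwards, so only
distances are carried over. -/
lemma step_knownDist (hg : ∀ i, (g i).Connected) {q : ℕ} [Fact q.Prime] (hq : n < q) (d t : ℕ) :
    Step g (n * (n + 1) ^ n * ((q ^ (2 * d)) ^ n * (q ^ n * q ^ n)))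
      (fun i => (src i, knownDist (g i) (hg i) (src i) d t))
      (fun i => (src i, knownDist (g i) (hg i) (src i) d (t + 1))) := by
  classical
  obtain ⟨Φ, hΦ⟩ := exists_sparse_sketch (κ := Fin n) (q := q) (by simpa using hq.le) d
  refine ⟨(Fin n → Fin (2 * d) → ZMod q) × (Fin n → ZMod q) × (Fin n → ZMod q), inferInstance,
    inferInstance, fun x e => (fun v => Φ fun w => nbrQuery (ZMod q) v (fun u => u = w) e,
      fun v => nbrQuery (ZMod q) v (fun _ => True) e,
      fun v => nbrQuery (ZMod q) v (fun u => x.2 u ≠ none) e), by simp [ZMod.card],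
    fun i j h hA => ?_⟩
  simp only [Prod.mk.injEq] at h ⊢
  obtain ⟨hs, hk⟩ := h
  simp only [edgeSum_prod, Prod.mk.injEq] at hA
  obtain ⟨hrow, hdeg, hnbr⟩ := hA
  have hdeg' : ∀ v, nbrNum (g i) v = nbrNum (g j) v := by
    intro v
    have := congrFun hdeg v
    rw [edgeSum_apply, edgeSum_apply, edgeSum_nbrQuery, edgeSum_nbrQuery] at this
    simpa [nbrNum] using card_nbr_eq_of_cast_eq hq this
  have hlow : ∀ v, nbrNum (g i) v ≤ d → ∀ u, (g i).Adj u v ↔ (g j).Adj u v := by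
    intro v hv u
    have := congrFun hrow v
    rw [edgeSum_apply, edgeSum_apply, edgeSum_sketch Φ (g i) (fun _ => v) (fun w u => u = w),
      edgeSum_sketch Φ (g j) (fun _ => v) (fun w u => u = w)] at this
    have := congrFun (hΦ _ _ {u | (g i).Adj u v} {u | (g j).Adj u v}
      (fun w hw => nbrCounts_eq_zero fun u hu huw => hw (by simpa [← huw] using hu))
      (fun w hw => nbrCounts_eq_zero fun u hu huw => hw (by simpa [← huw] using hu))
      hv ((hdeg' v).symm.le.trans hv) this) u
    simpa using exists_adj_iff_of_edgeSum_eq hq this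
  refine ⟨hs, ?_⟩
  have hsrc : ∀ t, knownDist (g j) (hg j) (src j) d t = knownDist (g j) (hg j) (src i) d t := by
    rw [hs]; exact fun _ => rfl
  rw [hsrc] at hk ⊢
  refine knownDist_succ_eq_of_agree (hg i) (hg j) hlow hdeg' hk fun v => ?_
  have := congrFun hnbr v
  rw [edgeSum_apply, edgeSum_apply] at this
  simpa only [hsrc] using exists_adj_iff_of_edgeSum_eq hq this

/-- `T` passes by layers and `ℓ` passes for the parents. -/
lemma findsBFSTree_by_layers (hn : 0 < n) (hg : ∀ i, (g i).Connected) {q ℓ : ℕ} [Fact q.Prime]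
    (hq : n < q) (hℓ : n ≤ 2 ^ ℓ) {d T : ℕ} (hT : n * 3 < T * (d + 1)) :
    FindsBFSTree g src (T + ℓ)
      (T * (n * (n + 1) ^ n * ((q ^ (2 * d)) ^ n * (q ^ n * q ^ n))) +
        (ℓ * q ^ n + 1) * (n * n ^ n * n ^ n)) src := by
  have : Nonempty (Fin n) := ⟨⟨0, hn⟩⟩
  have h1 := findsBFSTree_of_dist (g := g) (src := src) hn hg hℓ hq
  have h2 : FindsBFSTree g src ℓ ((ℓ * q ^ n + 1) * (n * n ^ n * n ^ n))
      (fun i => (src i, knownDist (g i) (hg i) (src i) d T)) := by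
    refine h1.of_determined fun i j h => ?_
    -- By the choice of T there are fewer than T high layers, so after T passes no distance is
    -- missing.
    have hall : ∀ i v, knownDist (g i) (hg i) (src i) d T v
        = some ⟨(g i).dist (src i) v, dist_lt_card (hg i) _ _⟩ := by
      intro i v
      refine if_pos ?_
      have := card_highLayers_mul_le (hg i) (src i) d ((g i).dist (src i) v)
      exact lt_of_mul_lt_mul_right (this.trans_lt hT) (Nat.zero_le _)
    simp only [Prod.mk.injEq] at h
    refine Prod.ext h.1 (funext fun v => ?_)
    have := congrFun h.2 v
    rw [hall, hall, Option.some_inj] at this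
    exact this
  have h3 := FindsBFSTree.of_steps (fun t i => (src i, knownDist (g i) (hg i) (src i) d t)) T
    (fun t _ => step_knownDist hg hq d t) h2
  refine h3.of_determined (Y := src) fun i j h => ?_
  exact Prod.ext h (funext fun v => by simp [knownDist])

/-- In one pass, all edges can be stored. -/
lemma findsBFSTree_of_storing (hg : ∀ i, (g i).Connected) {p : ℕ} (hp : 1 ≤ p) :
    FindsBFSTree g src p ((p - 1) * n + (n * 2 ^ n ^ 2 + 2 ^ n ^ 2)) src := by
  classical
  have hcard : Fintype.card (SimpleGraph (Fin n)) ≤ 2 ^ n ^ 2 := by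
    have := Fintype.card_le_of_injective (fun G : SimpleGraph (Fin n) =>
      fun p : Fin n × Fin n => (decide (G.Adj p.1 p.2) : Bool)) fun G G' h => by
        ext u v; simpa using congrFun h (u, v)
    simpa [sq] using this
  have hsym : Fintype.card (Sym2 (Fin n)) ≤ n ^ 2 := by
    have := Fintype.card_le_of_surjective _ (Sym2.mk_surjective (α := Fin n))
    simpa [sq] using this
  have hex := fun (x : Fin n × {G : SimpleGraph (Fin n) // G.Connected}) =>
    exists_isBFSTree x.2.2 x.1
  choose T hT using hex
  have h1 : FindsBFSTree g src 0 (2 ^ n ^ 2) fun i => T (src i, ⟨g i, hg i⟩) :=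
    (FindsBFSTree.of_output _ id fun i => hT (src i, ⟨g i, hg i⟩)).mono hcard
  have h2 : Step g (n * 2 ^ n ^ 2) src fun i => T (src i, ⟨g i, hg i⟩) := by
    -- The answer is the edge indicator modulo 2, that is, the graph itself.
    refine ⟨Sym2 (Fin n) → ZMod 2, inferInstance, inferInstance, fun _ e => Pi.single e 1, ?_,
      fun i j h hA => ?_⟩
    · simp only [Fintype.card_fin, Fintype.card_fun, ZMod.card]
      gcongr
      norm_num
    · have hval : ∀ (G : SimpleGraph (Fin n)) e,
          edgeSum G (fun e => (Pi.single e 1 : Sym2 (Fin n) → ZMod 2)) e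
            = if e ∈ G.edgeSet then 1 else 0 := by
        intro G e
        simp [edgeSum, Finset.sum_apply, Pi.single_apply]
      have hgij : g i = g j := by
        rw [← SimpleGraph.edgeSet_inj]
        ext e
        have := congrFun hA e
        rw [hval, hval] at this
        by_cases h1 : e ∈ (g i).edgeSet <;> by_cases h2 : e ∈ (g j).edgeSet <;>
          simp [h1, h2] at this ⊢
      simp only [h, hgij]
  have := (h2.cons h1).idle hp
  simpa using this

end Layers

/-! ### Simultaneous breadth-first searches with delays -/

section Starts

variable {n : ℕ} {ι : Type} {x : ι → Fin n} {δ : ι → ℕ}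

open Classical in
/-- The distances between the starting nodes that are found up to time `t`. -/
noncomputable def foundDist (G : SimpleGraph (Fin n)) (hG : G.Connected) (x : ι → Fin n)
    (δ : ι → ℕ) (t : ℕ) (k l : ι) : Option (Fin n) :=
  if δ k + G.dist (x k) (x l) ≤ t then some ⟨G.dist (x k) (x l), dist_lt_card hG _ _⟩ else none

/-- The distances between the starting nodes up to `h` determine their distances from `s`, if there
is a starting node among the last `h` nodes before the end of every longer shortest path. -/
lemma dist_start_le_of_foundDist {G G' : SimpleGraph (Fin n)} (hG : G.Connected)
    (hG' : G'.Connected) {s : Fin n} {h T : ℕ} {j₀ : ι} (hj₀ : x j₀ = s)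
    (hδ : ∀ j, δ j + h ≤ T)
    (hit : ∀ v, h < G.dist s v → ∃ j, G.dist s (x j) + G.dist (x j) v = G.dist s v ∧
      0 < G.dist (x j) v ∧ G.dist (x j) v ≤ h)
    (hD : foundDist G hG x δ T = foundDist G' hG' x δ T) (k : ι) :
    G'.dist s (x k) ≤ G.dist s (x k) := by
  have hD' : ∀ k l, G.dist (x k) (x l) ≤ h → G'.dist (x k) (x l) = G.dist (x k) (x l) := by
    intro k l hkl
    have h1 := congrFun (congrFun hD k) l
    have h2 := hδ k
    simp only [foundDist] at h1
    rw [if_pos (by omega)] at h1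
    split_ifs at h1
    simp only [Option.some_inj, Fin.mk.injEq] at h1
    exact h1.symm
  induction hm : G.dist s (x k) using Nat.strong_induction_on generalizing k with
  | _ m ih =>
    by_cases hmh : m ≤ h
    · have := hD' j₀ k (by rw [hj₀]; omega)
      rw [hj₀] at this
      omega
    -- A starting node strictly before the end of the path is closer to `s`, so induction applies to
    -- it, and the remaining piece is short enough to be in the table.
    · obtain ⟨j, h1, h2, h3⟩ := hit (x k) (by omega)
      have h4 := ih _ (by omega) j rfl
      have h5 := hD' j k h3
      have h6 := hG'.dist_triangle (u := s) (v := x j) (w := x k)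
      omega

end Starts

/-! ### Frontiers of the delayed searches, and their recovery from the stream -/

section Sweep

variable {n : ℕ} {ι : Type} [Fintype ι]

open Classical in
/-- The pairs `(j, v)` for which the search from `x j`, started at time `δ j`, reaches `v` at
time `t`. -/
noncomputable def frontier (G : SimpleGraph (Fin n)) (x : ι → Fin n) (δ : ι → ℕ) (t : ℕ) :
    Finset (ι × Fin n) :=
  {k | δ k.1 + G.dist (x k.1) k.2 = t}

open Classical in
/-- The pairs that were reached one step before time `t`. -/
noncomputable def oldFrontier (G : SimpleGraph (Fin n)) (x : ι → Fin n) (δ : ι → ℕ) (t : ℕ) :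
    Finset (ι × Fin n) :=
  {k | δ k.1 + G.dist (x k.1) k.2 + 1 = t}

variable {G : SimpleGraph (Fin n)} {x : ι → Fin n} {δ : ι → ℕ} {t : ℕ}

lemma mem_frontier {k : ι × Fin n} : k ∈ frontier G x δ t ↔ δ k.1 + G.dist (x k.1) k.2 = t := by
  simp [frontier]

lemma mem_oldFrontier {k : ι × Fin n} :
    k ∈ oldFrontier G x δ t ↔ δ k.1 + G.dist (x k.1) k.2 + 1 = t := by
  simp [oldFrontier]

lemma oldFrontier_succ : oldFrontier G x δ (t + 1) = frontier G x δ t := by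
  ext k; rw [mem_frontier, mem_oldFrontier]; omega

/-- Neighbours of a reached node differ from it in depth by at most one, so removing the current and
the previous frontier leaves the next one. The first alternative is a search whose delay has just
elapsed. -/
lemma mem_frontier_succ (hG : G.Connected) {k : ι × Fin n} :
    k ∈ frontier G x δ (t + 1) ↔ (δ k.1 = t + 1 ∧ k.2 = x k.1) ∨
      ((∃ u, G.Adj u k.2 ∧ (k.1, u) ∈ frontier G x δ t) ∧
        k ∉ frontier G x δ t ∧ k ∉ oldFrontier G x δ t) := by
  simp only [mem_frontier, mem_oldFrontier]
  constructor
  · intro h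
    rcases Nat.eq_zero_or_eq_succ_pred (G.dist (x k.1) k.2) with h0 | h0
    · exact .inl ⟨by omega, (hG.dist_eq_zero_iff.1 h0).symm⟩
    · obtain ⟨u, hu, hd⟩ := exists_adj_dist_eq hG h0
      exact .inr ⟨⟨u, hu, by omega⟩, by omega, by omega⟩
  · rintro (⟨h1, h2⟩ | ⟨⟨u, hu, hd⟩, h1, h2⟩)
    · rw [h2, SimpleGraph.dist_self, h1, add_zero]
    · have h3 := dist_le_dist_add_one hG hu (x k.1)
      have h4 := dist_le_dist_add_one hG hu.symm (x k.1)
      omega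

lemma card_oldFrontier_le {M T : ℕ} (hM : ∀ t ≤ T, #(frontier G x δ t) ≤ M) (ht : t ≤ T) :
    #(oldFrontier G x δ t) ≤ M := by
  rcases t with - | t
  · have : oldFrontier G x δ 0 = ∅ := by ext k; simp [mem_oldFrontier]
    simp [this]
  · rw [oldFrontier_succ]
    exact hM t (by omega)

/-- A finite set with at most `M` elements, and the empty set otherwise. -/
def smallFinset {κ : Type} (M : ℕ) (s : Finset κ) : {s : Finset κ // #s ≤ M} :=
  if h : #s ≤ M then ⟨s, h⟩ else ⟨∅, by simp⟩

lemma coe_smallFinset {κ : Type} {M : ℕ} {s : Finset κ} (h : #s ≤ M) :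
    (smallFinset M s : Finset κ) = s := by
  simp [smallFinset, h]

variable {I : Type} {g : I → SimpleGraph (Fin n)} {src : I → Fin n} {β γ : Type} [Fintype β]
  [Fintype γ]

/-- While the delayed searches run for `T` passes, information `acc` is collected from the pairs that
are reached. -/
lemma FindsBFSTree.sweep (hg : ∀ i, (g i).Connected) {q : ℕ} [Fact q.Prime]
    (hq : n < q) (hq' : Fintype.card ι * n ≤ q) {p N M T : ℕ} (b : I → β) (x : I → ι → Fin n)
    (δ : I → ι → ℕ) (hx : ∀ i j, b i = b j → x i = x j) (hδ : ∀ i j, b i = b j → δ i = δ j)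
    (hM : ∀ i, ∀ t ≤ T, #(frontier (g i) (x i) (δ i) t) ≤ M) (acc : ℕ → I → γ)
    (hacc : ∀ t < T, ∀ i j, b i = b j → acc t i = acc t j →
      frontier (g i) (x i) (δ i) (t + 1) = frontier (g j) (x j) (δ j) (t + 1) →
        acc (t + 1) i = acc (t + 1) j)
    (h : FindsBFSTree g src p N fun i => (b i, acc T i)) :
    FindsBFSTree g src (T + p) (T * (Fintype.card β * Fintype.card γ *
      (Fintype.card ι * n + 1) ^ M * (Fintype.card ι * n + 1) ^ M * q ^ (2 * (3 * M))) + N)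
      fun i => (b i, acc 0 i) := by
  classical
  obtain ⟨Φ, hΦ⟩ := exists_sparse_sketch (κ := ι × Fin n) (q := q) (by simpa using hq') (3 * M)
  let S : Type := {s : Finset (ι × Fin n) // #s ≤ M}
  have hS : Fintype.card S ≤ (Fintype.card ι * n + 1) ^ M := by
    simpa using card_small_finset_le (ι × Fin n) M
  let F : ℕ → I → Finset (ι × Fin n) := fun t i => frontier (g i) (x i) (δ i) t
  let O : ℕ → I → Finset (ι × Fin n) := fun t i => oldFrontier (g i) (x i) (δ i) t
  have hO : ∀ i, ∀ t ≤ T, #(O t i) ≤ M := fun i t ht => card_oldFrontier_le (hM i) ht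
  let X : ℕ → I → (β × γ) × S × S := fun t i =>
    ((b i, acc t i), smallFinset M (O t i), smallFinset M (F t i))
  have hstep : ∀ t < T, Step g (Fintype.card β * Fintype.card γ *
      (Fintype.card ι * n + 1) ^ M * (Fintype.card ι * n + 1) ^ M * q ^ (2 * (3 * M)))
      (X t) (X (t + 1)) := by
    intro t ht
    refine ⟨Fin (2 * (3 * M)) → ZMod q, inferInstance, inferInstance, fun s e =>
      Φ fun k => nbrQuery (ZMod q) k.2 (fun u => (k.1, u) ∈ s.2.2.1) e, ?_, fun i j hij hA => ?_⟩
    · simp only [Fintype.card_prod, Fintype.card_fun, ZMod.card, Fintype.card_fin]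
      rw [mul_assoc (Fintype.card β * Fintype.card γ) (_ ^ M)]
      gcongr
    have hFi := hM i t ht.le
    have hFj := hM j t ht.le
    simp only [X, Prod.mk.injEq] at hij
    obtain ⟨⟨hb, ha⟩, hOij, hFij⟩ := hij
    replace hOij := congrArg Subtype.val hOij
    replace hFij := congrArg Subtype.val hFij
    rw [coe_smallFinset (hO i t ht.le), coe_smallFinset (hO j t ht.le)] at hOij
    simp only [F, coe_smallFinset hFi, coe_smallFinset hFj] at hFij
    -- The counts vanish outside three consecutive frontiers, whence the sparsity 3M.
    have hsupp : ∀ i k, k ∉ O t i ∪ F t i ∪ F (t + 1) i → nbrCounts q (g i) Prod.snd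
        (fun k u => (k.1, u) ∈ (X t i).2.2.1) k = 0 := by
      intro i k hk
      refine nbrCounts_eq_zero fun u hu hku => hk ?_
      simp only [X, coe_smallFinset (hM i t ht.le), F] at hku
      simp only [mem_union]
      by_cases h1 : k ∈ O t i
      · exact .inl (.inl h1)
      by_cases h2 : k ∈ F t i
      · exact .inl (.inr h2)
      · exact .inr ((mem_frontier_succ (hg i)).2 (.inr ⟨⟨u, hu, hku⟩, h2, h1⟩))
    have hcard : ∀ i, #(O t i ∪ F t i ∪ F (t + 1) i) ≤ 3 * M := by
      intro i
      have h1 := card_union_le (O t i ∪ F t i) (F (t + 1) i)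
      have h2 := card_union_le (O t i) (F t i)
      have h3 := hO i t ht.le
      have h4 : #(F t i) ≤ M := hM i t ht.le
      have h5 : #(F (t + 1) i) ≤ M := hM i (t + 1) ht
      omega
    have hsk := fun i => edgeSum_sketch Φ (g i) Prod.snd
      (fun k : ι × Fin n => fun u => (k.1, u) ∈ (X t i).2.2.1)
    have hA' := (hsk i).symm.trans (hA.trans (hsk j))
    have hcount := hΦ _ _ _ _ (hsupp i) (hsupp j) (hcard i) (hcard j) hA'
    have hFsucc : frontier (g i) (x i) (δ i) (t + 1) = frontier (g j) (x j) (δ j) (t + 1) := by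
      ext k
      have := exists_adj_iff_of_edgeSum_eq hq (congrFun hcount k)
      simp only [X, coe_smallFinset hFi, coe_smallFinset hFj, F] at this
      rw [mem_frontier_succ (hg i), mem_frontier_succ (hg j), this, hFij, hx i j hb, hδ i j hb]
      simp only [O] at hOij
      rw [hx i j hb, hδ i j hb] at hOij
      rw [hOij]
    simp only [X, Prod.mk.injEq, F, O, oldFrontier_succ]
    exact ⟨⟨hb, hacc t ht i j hb ha hFsucc⟩, by rw [hFij], by rw [hFsucc]⟩
  have hX := FindsBFSTree.of_steps X T hstep (h.comp (f := Prod.fst) fun i => rfl)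
  have : Nonempty S := ⟨⟨∅, by simp⟩⟩
  refine hX.of_snd_determined fun i j hij => ?_
  simp only [Prod.mk.injEq] at hij
  have hF0 : F 0 i = F 0 j := by
    ext k
    simp only [F, mem_frontier, Nat.add_eq_zero_iff,
      (hg i).dist_eq_zero_iff, (hg j).dist_eq_zero_iff, hx i j hij.1, hδ i j hij.1]
  have hO0 : O 0 i = O 0 j := by
    ext k
    simp [O, mem_oldFrontier]
  simp only [hF0, hO0]

/-- The time at which a search arrives, minus its delay, is the distance; the frontier alone thus
updates the table. -/
lemma foundDist_succ_eq {G G' : SimpleGraph (Fin n)} (hG : G.Connected) (hG' : G'.Connected)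
    (h : foundDist G hG x δ t = foundDist G' hG' x δ t)
    (hF : frontier G x δ (t + 1) = frontier G' x δ (t + 1)) :
    foundDist G hG x δ (t + 1) = foundDist G' hG' x δ (t + 1) := by
  funext k l
  have h1 := congrFun (congrFun h k) l
  have h2 := Finset.ext_iff.1 hF (k, x l)
  simp only [mem_frontier] at h2
  simp only [foundDist] at h1 ⊢
  split_ifs at h1 ⊢ <;> simp only [Option.some_inj, Fin.mk.injEq] at h1 ⊢ <;> omega

open Classical in
/-- The least length, capped by `n`, of a path from `s` to `v` through a starting node that is found
up to time `t`, when `dS` are the distances of the starting nodes from `s`. -/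
noncomputable def foundLength (G : SimpleGraph (Fin n)) (x : ι → Fin n) (δ dS : ι → ℕ) (t : ℕ)
    (v : Fin n) : Fin (n + 1) :=
  univ.inf fun j => if δ j + G.dist (x j) v ≤ t then
    ⟨min (dS j + G.dist (x j) v) n, by omega⟩ else ⊤

lemma foundLength_succ (G : SimpleGraph (Fin n)) (x : ι → Fin n) (δ dS : ι → ℕ) (t : ℕ)
    (v : Fin n) [DecidableEq ι] :
    foundLength G x δ dS (t + 1) v = foundLength G x δ dS t v ⊓
      univ.inf fun j => if (j, v) ∈ frontier G x δ (t + 1) then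
        (⟨min (dS j + (t + 1 - δ j)) n, by omega⟩ : Fin (n + 1)) else ⊤ := by
  rw [foundLength, foundLength, ← Finset.inf_inf]
  refine Finset.inf_congr rfl fun j _ => ?_
  simp only [mem_frontier, Pi.inf_apply]
  by_cases h1 : δ j + G.dist (x j) v ≤ t
  · rw [if_pos (by omega), if_pos h1, if_neg (by omega), inf_top_eq]
  · rw [if_neg h1, top_inf_eq]
    by_cases h2 : δ j + G.dist (x j) v = t + 1
    · rw [if_pos (by omega), if_pos h2]
      have : t + 1 - δ j = G.dist (x j) v := by omega
      simp only [this]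
    · rw [if_neg (by omega), if_neg h2]

/-- No recorded length is too short, by the triangle inequality. The true distance is attained
through the starting node supplied by `hit`, or through `s` itself for near nodes, and a search has
at least h steps after its delay. -/
lemma foundLength_eq {G : SimpleGraph (Fin n)} (hG : G.Connected) {s : Fin n} {h T : ℕ} {j₀ : ι}
    (hj₀ : x j₀ = s) (hδ : ∀ j, δ j + h ≤ T)
    (hit : ∀ v, h < G.dist s v → ∃ j, G.dist s (x j) + G.dist (x j) v = G.dist s v ∧
      0 < G.dist (x j) v ∧ G.dist (x j) v ≤ h) (v : Fin n) :
    (foundLength G x δ (fun j => G.dist s (x j)) T v : ℕ) = G.dist s v := by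
  have hn := dist_lt_card hG s v
  have hex : ∃ j, G.dist s (x j) + G.dist (x j) v = G.dist s v ∧ G.dist (x j) v ≤ h := by
    by_cases hv : G.dist s v ≤ h
    · exact ⟨j₀, by simp [hj₀], by rwa [hj₀]⟩
    · obtain ⟨j, h1, -, h2⟩ := hit v (by omega)
      exact ⟨j, h1, h2⟩
  suffices foundLength G x δ (fun j => G.dist s (x j)) T v = ⟨G.dist s v, by omega⟩ by rw [this]
  refine le_antisymm ?_ (Finset.le_inf fun j _ => ?_)
  · obtain ⟨j, h1, h2⟩ := hex
    refine (Finset.inf_le (mem_univ j)).trans ?_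
    have := hδ j
    rw [if_pos (by omega), Fin.mk_le_mk]
    beta_reduce
    omega
  · have := hG.dist_triangle (u := s) (v := x j) (w := v)
    split_ifs
    · rw [Fin.mk_le_mk]
      beta_reduce
      omega
    · exact le_top

/-- A number of states that is enough for two sweeps, of `T` passes each, and `ℓ` further passes. -/
def sweepStates (n B K M T ℓ q : ℕ) : ℕ :=
  T * (B * ((n + 1) ^ K) ^ K * (K * n + 1) ^ M * (K * n + 1) ^ M * q ^ (2 * (3 * M))) +
    (T * (B * n ^ K * (n + 1) ^ n * (K * n + 1) ^ M * (K * n + 1) ^ M *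
      q ^ (2 * (3 * M))) + (ℓ * q ^ n + 1) * (n * n ^ n * n ^ n))

/-- Two sweeps are needed because lengths from `s` can be minimized on the fly only once the
distances of the starting nodes from `s` are known. The stages are assembled from the last one
backwards. -/
lemma findsBFSTree_by_sweeps (hn : 0 < n) (hg : ∀ i, (g i).Connected) {q ℓ : ℕ} [Fact q.Prime]
    (hℓ : n ≤ 2 ^ ℓ) (hq : n < q) (hq' : Fintype.card ι * n ≤ q) {h M T : ℕ}
    (b : I → β) (x : I → ι → Fin n)
    (δ : I → ι → ℕ) (hx : ∀ i j, b i = b j → x i = x j) (hδ : ∀ i j, b i = b j → δ i = δ j)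
    (hsrc : ∀ i j, b i = b j → src i = src j) (j₀ : ι) (hj₀ : ∀ i, x i j₀ = src i)
    (hδh : ∀ i j, δ i j + h ≤ T)
    (hM : ∀ i, ∀ t ≤ T, #(frontier (g i) (x i) (δ i) t) ≤ M)
    (hit : ∀ i v, h < (g i).dist (src i) v → ∃ j,
      (g i).dist (src i) (x i j) + (g i).dist (x i j) v = (g i).dist (src i) v ∧
        0 < (g i).dist (x i j) v ∧ (g i).dist (x i j) v ≤ h) :
    FindsBFSTree g src (T + (T + ℓ))
      (sweepStates n (Fintype.card β) (Fintype.card ι) M T ℓ q) b := by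
  classical
  have : Nonempty (Fin n) := ⟨⟨0, hn⟩⟩
  let dS : I → ι → Fin n := fun i k => ⟨(g i).dist (src i) (x i k), dist_lt_card (hg i) _ _⟩
  let len : ℕ → I → Fin n → Fin (n + 1) := fun t i =>
    foundLength (g i) (x i) (δ i) (fun j => dS i j) t
  let D : ℕ → I → ι → ι → Option (Fin n) := fun t i => foundDist (g i) (hg i) (x i) (δ i) t
  have h1 : FindsBFSTree g src ℓ ((ℓ * q ^ n + 1) * (n * n ^ n * n ^ n))
      fun i => ((b i, dS i), len T i) := by
    refine (findsBFSTree_of_dist (g := g) (src := src) hn hg hℓ hq).of_determined fun i j hij => ?_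
    simp only [Prod.mk.injEq] at hij
    refine Prod.ext (hsrc i j hij.1.1) (funext fun v => Fin.ext ?_)
    have hlen := fun i => foundLength_eq (hg i) (hj₀ i) (hδh i) (hit i) v
    exact (hlen i).symm.trans ((congrArg Fin.val (congrFun hij.2 v)).trans (hlen j))
  have h2 := h1.sweep hg hq hq' (fun i => (b i, dS i)) x δ
    (fun i j h => hx i j (Prod.mk.inj h).1) (fun i j h => hδ i j (Prod.mk.inj h).1) hM len
    fun t ht i j hb ha hF => by
      obtain ⟨hb, hd⟩ := Prod.mk.inj hb
      funext v
      have := congrFun ha v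
      simp only [len] at this
      simp only [len]
      rw [foundLength_succ, foundLength_succ, this, hF, hδ i j hb, hd]
  -- The table of the first sweep fixes the distances from the source, so the second sweep keeps
  -- these K numbers in place of the K^2 entries.
  have hdet : ∀ i j, b i = b j → D T i = D T j → dS i = dS j ∧ len 0 i = len 0 j := by
    intro i j hb hD
    have hD' := hD
    simp only [D] at hD'
    have hdS : dS i = dS j := by
      have hxi := hx i j hb
      have hδi := hδ i j hb
      have hsi := hsrc i j hb
      have hiti := hit i
      have hitj := hit j
      rw [← hxi, ← hsi] at hitj
      rw [← hxi, ← hδi] at hD'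
      funext k
      refine Fin.ext (le_antisymm ?_ ?_)
      · simp only [dS, ← hxi, ← hsi]
        exact dist_start_le_of_foundDist (hg j) (hg i) (hj₀ i) (hδh i) hitj hD'.symm k
      · simp only [dS, ← hxi, ← hsi]
        exact dist_start_le_of_foundDist (hg i) (hg j) (hj₀ i) (hδh i) hiti hD' k
    have hlen : len 0 i = len 0 j := by
      funext v
      simp only [len, foundLength, Nat.le_zero, Nat.add_eq_zero_iff, (hg i).dist_eq_zero_iff,
        (hg j).dist_eq_zero_iff, hx i j hb, hδ i j hb, hdS]
      refine Finset.inf_congr rfl fun k _ => ?_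
      split_ifs with hk
      · simp only [hk.2, SimpleGraph.dist_self]
      · rfl
    exact ⟨hdS, hlen⟩
  have h3 := (h2.comp (Y := fun i => ((b i, D T i), dS i, len 0 i))
    (f := fun y => ((y.1.1, y.2.1), y.2.2)) fun i => rfl).of_snd_determined fun i j hij => by
      obtain ⟨hb, hD⟩ := Prod.mk.inj hij
      obtain ⟨h1, h2⟩ := hdet i j hb hD
      rw [h1, h2]
  have h4 := h3.sweep hg hq hq' b x δ hx hδ hM D fun t ht i j hb ha hF => by
    have hxi := hx i j hb
    have hδi := hδ i j hb
    simp only [D] at ha ⊢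
    rw [← hxi, ← hδi] at ha hF ⊢
    exact foundDist_succ_eq (hg i) (hg j) ha hF
  refine (h4.of_snd_determined fun i j hb => ?_).mono (by simp [sweepStates])
  · have hxi := hx i j hb
    have hδi := hδ i j hb
    funext k l
    simp only [D, foundDist, Nat.le_zero, Nat.add_eq_zero_iff, (hg i).dist_eq_zero_iff,
        (hg j).dist_eq_zero_iff, hxi, hδi]
    split_ifs with hk
    · simp only [hk.2, SimpleGraph.dist_self]
    · rfl

end Sweep

/-! ### Random starting nodes and delays -/

section Probability

lemma exp_le_one_add_two_mul {x : ℝ} (h0 : 0 ≤ x) (h1 : x ≤ 1) : Real.exp x ≤ 1 + 2 * x := by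
  have := Real.abs_exp_sub_one_sub_id_le (x := x) (abs_le.2 ⟨by linarith, h1⟩)
  have := (abs_le.1 this).2
  nlinarith

/-- A Chernoff bound for the sum of independent numbers in `[0, n]` with expectation at most
`n / h`. -/
lemma card_lt_sum_le {ι : Type*} [Fintype ι] [DecidableEq ι] {n h : ℕ} (hn : 0 < n) (hh : 0 < h)
    (f : ι → Fin h → ℕ) (hf : ∀ j d, f j d ≤ n) (hsum : ∀ j, ∑ d, f j d ≤ n) (M : ℕ) :
    (#{δ : ι → Fin h | M < ∑ j, f j (δ j)} : ℝ) ≤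
      (h : ℝ) ^ Fintype.card ι * Real.exp (2 * Fintype.card ι / h - M / n) := by
  have hn' : (0 : ℝ) < n := by exact_mod_cast hn
  have hh' : (0 : ℝ) < h := by exact_mod_cast hh
  -- Dividing by n brings the numbers into [0, 1], where exp x ≤ 1 + 2x; the bound is then Markov's
  -- inequality for the exponential of the sum.
  have h1 : ∀ j, ∑ d, Real.exp ((f j d : ℝ) / n) ≤ h * Real.exp (2 / h) := by
    intro j
    calc ∑ d, Real.exp ((f j d : ℝ) / n) ≤ ∑ d : Fin h, (1 + 2 * ((f j d : ℝ) / n)) := by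
          refine sum_le_sum fun d _ => exp_le_one_add_two_mul (by positivity) ?_
          rw [div_le_one hn']
          exact_mod_cast hf j d
      _ = h + 2 * ((∑ d, f j d : ℕ) / n) := by
          rw [sum_add_distrib, ← mul_sum, ← sum_div]
          simp
      _ ≤ h + 2 := by
          have : ((∑ d, f j d : ℕ) : ℝ) / n ≤ 1 := by
            rw [div_le_one hn']
            exact_mod_cast hsum j
          linarith
      _ = h * (2 / h + 1) := by field_simp; ring
      _ ≤ h * Real.exp (2 / h) := by gcongr; exact Real.add_one_le_exp _
  have h2 : ∑ δ : ι → Fin h, Real.exp ((∑ j, f j (δ j) : ℕ) / n)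
      ≤ (h : ℝ) ^ Fintype.card ι * Real.exp (2 * Fintype.card ι / h) := by
    calc ∑ δ : ι → Fin h, Real.exp ((∑ j, f j (δ j) : ℕ) / n)
        = ∑ δ : ι → Fin h, ∏ j, Real.exp ((f j (δ j) : ℝ) / n) := by
          refine sum_congr rfl fun δ _ => ?_
          rw [← Real.exp_sum, ← sum_div]
          push_cast
          rfl
      _ = ∏ j, ∑ d, Real.exp ((f j d : ℝ) / n) := by
          rw [prod_univ_sum, Fintype.piFinset_univ]
      _ ≤ ∏ _j : ι, (h * Real.exp (2 / h)) :=
          prod_le_prod (fun j _ => sum_nonneg fun d _ => (Real.exp_pos _).le) fun j _ => h1 j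
      _ = (h : ℝ) ^ Fintype.card ι * Real.exp (2 * Fintype.card ι / h) := by
          rw [prod_const, card_univ, mul_pow, ← Real.exp_nat_mul]
          congr 2
          ring
  rw [Real.exp_sub, ← mul_div_assoc, le_div_iff₀ (Real.exp_pos _)]
  refine le_trans ?_ h2
  rw [card_eq_sum_ones, Nat.cast_sum, sum_mul]
  refine (sum_le_sum fun δ hδ => ?_).trans (sum_le_sum_of_subset_of_nonneg (filter_subset _ _)
    fun δ _ _ => (Real.exp_pos _).le)
  rw [Nat.cast_one, one_mul, Real.exp_le_exp]
  gcongr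
  exact (mem_filter.1 hδ).2.le

variable {n : ℕ}

/-- The starting nodes: the source, and nodes given by random numbers below `N`. -/
def startNode {K N : ℕ} (s : Fin n) (x : Fin K → Fin N) : Option (Fin K) → Fin n
  | none => s
  | some j => if h : (x j : ℕ) < n then ⟨x j, h⟩ else s

/-- The range N may exceed n, so that it can be a power of two and a number be given by coin tosses.
Numbers from n on fall back to the source; missing W still excludes at least h values in each
coordinate. -/
lemma card_miss_le {K N h : ℕ} (hN : n ≤ N) (s : Fin n) (W : Finset (Fin n)) (hW : h ≤ #W) :
    #{x : Fin K → Fin N | ∀ j, startNode s x (some j) ∉ W} ≤ (N - h) ^ K := by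
  classical
  let W' : Finset (Fin N) := W.map (Fin.castLEEmb hN)
  have hsub : ({x : Fin K → Fin N | ∀ j, startNode s x (some j) ∉ W} : Finset _)
      ⊆ Fintype.piFinset fun _ => W'ᶜ := by
    intro x hx
    rw [Fintype.mem_piFinset]
    intro j
    rw [mem_compl]
    intro hj
    obtain ⟨w, hw, hwj⟩ := mem_map.1 hj
    refine (mem_filter.1 hx).2 j ?_
    have : (x j : ℕ) = w := by rw [← hwj]; rfl
    have hlt : (x j : ℕ) < n := this ▸ w.2
    have h2 : startNode s x (some j) = w := by
      simp only [startNode, dif_pos hlt]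
      exact Fin.ext this
    rwa [h2]
  refine (card_le_card hsub).trans ?_
  rw [Fintype.card_piFinset_const, card_compl, Fintype.card_fin, card_map]
  exact Nat.pow_le_pow_left (by omega) _

/-- The delays and the starting nodes keep the frontiers small, and there is a starting node among
the last `h` nodes before the end of every shortest path from `s` that is longer than `h`. -/
def GoodSeed {K N h : ℕ} (T M : ℕ) (G : SimpleGraph (Fin n)) (s : Fin n)
    (ω : (Fin K → Fin N) × (Option (Fin K) → Fin h)) : Prop :=
  (∀ t ≤ T, #(frontier G (startNode s ω.1) (fun j => ω.2 j) t) ≤ M) ∧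
    ∀ v, h < G.dist s v → ∃ j, G.dist s (startNode s ω.1 j) + G.dist (startNode s ω.1 j) v
      = G.dist s v ∧ 0 < G.dist (startNode s ω.1 j) v ∧ G.dist (startNode s ω.1 j) v ≤ h

-- For each k from 1 to h, a shortest path to `v` has a node at distance k from `v`, so at least h
-- nodes are suitable as starting nodes.
open Classical in
lemma card_not_hit_le {K N h : ℕ} (hN : n ≤ N) {G : SimpleGraph (Fin n)} (hG : G.Connected)
    (s v : Fin n) (hv : h < G.dist s v) :
    #{x : Fin K → Fin N | ¬ ∃ j, G.dist s (startNode s x j) + G.dist (startNode s x j) v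
      = G.dist s v ∧ 0 < G.dist (startNode s x j) v ∧ G.dist (startNode s x j) v ≤ h}
      ≤ (N - h) ^ K := by
  let W : Finset (Fin n) := {u | G.dist s u + G.dist u v = G.dist s v ∧ 0 < G.dist u v ∧
    G.dist u v ≤ h}
  have hW : h ≤ #W := by
    have hsub : Icc 1 h ⊆ W.image fun u => G.dist u v := by
      intro k hk
      rw [mem_Icc] at hk
      obtain ⟨u, h1, h2⟩ := exists_dist_add_dist_eq hG (s := s) (v := v) (k := G.dist s v - k)
        (by omega)
      exact mem_image.2 ⟨u, by simp only [W, mem_filter, mem_univ, true_and]; omega, by omega⟩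
    have := (card_le_card hsub).trans card_image_le
    simpa using this
  refine le_trans (card_le_card fun x hx => ?_) (card_miss_le (K := K) hN s W hW)
  simp only [mem_filter, mem_univ, true_and, not_exists] at hx
  simp only [mem_filter, mem_univ, true_and]
  exact fun j hj => hx (some j) (by simpa [W] using hj)

-- For a fixed search and time, different delays give disjoint layers. Their sizes sum to at most n,
-- which is the hypothesis of the Chernoff bound.
open Classical in
lemma card_heavy_le {ι : Type} [Fintype ι] [DecidableEq ι] {h : ℕ} (hn : 0 < n) (hh : 0 < h)
    (G : SimpleGraph (Fin n)) (x : ι → Fin n) (t M : ℕ) :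
    (#{δ : ι → Fin h | M < #(frontier G x (fun j => δ j) t)} : ℝ) ≤
      (h : ℝ) ^ Fintype.card ι * Real.exp (2 * Fintype.card ι / h - M / n) := by
  have := card_lt_sum_le hn hh (fun j (d : Fin h) => #{v | (d : ℕ) + G.dist (x j) v = t})
    (fun j d => (card_le_univ _).trans (by simp)) (fun j => ?_) M
  · convert this using 5 with δ
    rw [frontier, card_eq_sum_ones, sum_filter, Fintype.sum_prod_type]
    refine sum_congr rfl fun j _ => ?_
    rw [← sum_filter, ← card_eq_sum_ones]
  · rw [← card_biUnion]
    · exact (card_le_univ _).trans (by simp)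
    · intro d _ d' _ hdd
      rw [Function.onFun, disjoint_left]
      intro v hv hv'
      simp only [mem_filter, mem_univ, true_and] at hv hv'
      exact hdd (Fin.ext (by omega))

lemma card_filter_prod {α β : Type*} [Fintype α] [Fintype β] (P : α × β → Prop) [DecidablePred P] :
    #{ω | P ω} = ∑ a, #{b | P (a, b)} := by
  simp only [card_filter, Fintype.sum_prod_type]

-- Union bound over n end nodes and T + 1 times, written as a count of seeds. Missing an end node
-- depends only on the starting nodes; for the frontier sizes these are fixed and only the delays
-- vary.
open Classical in
lemma le_card_goodSeed {K N h : ℕ} (T M : ℕ) (hn : 0 < n) (hh : 0 < h) (hN : n ≤ N) (hhN : h ≤ N)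
    {G : SimpleGraph (Fin n)} (hG : G.Connected) (s : Fin n) :
    (1 - n * (1 - (h : ℝ) / N) ^ K - (T + 1) * Real.exp (2 * (K + 1 : ℕ) / h - M / n)) *
      ((N : ℝ) ^ K * (h : ℝ) ^ (K + 1)) ≤
      (#{ω : (Fin K → Fin N) × (Option (Fin K) → Fin h) | GoodSeed T M G s ω} : ℝ) := by
  let Ω := (Fin K → Fin N) × (Option (Fin K) → Fin h)
  let hit : (Fin K → Fin N) → Fin n → Prop := fun x v =>
    ∃ j, G.dist s (startNode s x j) + G.dist (startNode s x j) v
      = G.dist s v ∧ 0 < G.dist (startNode s x j) v ∧ G.dist (startNode s x j) v ≤ h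
  let B : Fin n → Finset Ω := fun v => {ω | h < G.dist s v ∧ ¬ hit ω.1 v}
  let B' : ℕ → Finset Ω := fun t => {ω | M < #(frontier G (startNode s ω.1) (fun j => ω.2 j) t)}
  have hN' : (0 : ℝ) < N := by exact_mod_cast hn.trans_le hN
  have hΩ : (Fintype.card Ω : ℝ) = (N : ℝ) ^ K * (h : ℝ) ^ (K + 1) := by simp [Ω]
  have hcover : (univ : Finset Ω) ⊆ ({ω | GoodSeed T M G s ω} : Finset Ω) ∪
      (univ.biUnion B ∪ (range (T + 1)).biUnion B') := by
    intro ω _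
    by_contra! hω
    simp only [mem_union, mem_biUnion, mem_filter, mem_univ, true_and, not_or, not_exists,
      not_and, mem_range, not_not, not_lt, B, B'] at hω
    exact hω.1 ⟨fun t ht => hω.2.2 t (by omega), fun v hv => hω.2.1 v hv⟩
  have hB : ∀ v, (#(B v) : ℝ) ≤ (1 - (h : ℝ) / N) ^ K * ((N : ℝ) ^ K * (h : ℝ) ^ (K + 1)) := by
    intro v
    by_cases hv : h < G.dist s v
    · have h1 : #(B v) ≤ (N - h) ^ K * h ^ (K + 1) := by
        simp only [B, hv, true_and]
        rw [card_filter_prod]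
        have : ∀ x : Fin K → Fin N, #{δ : Option (Fin K) → Fin h | ¬ hit (x, δ).1 v}
            = if ¬ hit x v then h ^ (K + 1) else 0 := by
          intro x
          split_ifs with hx
          · simp [hx]
          · simp [hx]
        rw [sum_congr rfl fun x _ => this x, ← sum_filter, sum_const, smul_eq_mul]
        exact Nat.mul_le_mul_right _ (card_not_hit_le hN hG s v hv)
      calc (#(B v) : ℝ) ≤ ((N - h) ^ K * h ^ (K + 1) : ℕ) := by exact_mod_cast h1
        _ = (1 - (h : ℝ) / N) ^ K * ((N : ℝ) ^ K * (h : ℝ) ^ (K + 1)) := by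
          push_cast [Nat.cast_sub hhN]
          rw [← mul_assoc, ← mul_pow]
          congr 2
          field_simp
    · have : B v = ∅ := by simp [B, hv]
      rw [this, card_empty, Nat.cast_zero]
      have : (h : ℝ) / N ≤ 1 := by
        rw [div_le_one hN']
        exact_mod_cast hhN
      have : 0 ≤ 1 - (h : ℝ) / N := by linarith
      positivity
  have hB' : ∀ t, (#(B' t) : ℝ) ≤ Real.exp (2 * (K + 1 : ℕ) / h - M / n) *
      ((N : ℝ) ^ K * (h : ℝ) ^ (K + 1)) := by
    intro t
    simp only [B']
    rw [card_filter_prod]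
    push_cast
    calc ∑ x : Fin K → Fin N, (#{δ : Option (Fin K) → Fin h |
          M < #(frontier G (startNode s x) (fun j => δ j) t)} : ℝ)
        ≤ ∑ x : Fin K → Fin N, ((h : ℝ) ^ (K + 1) *
          Real.exp (2 * (K + 1 : ℕ) / h - M / n)) := by
          refine sum_le_sum fun x _ => ?_
          have := card_heavy_le hn hh G (startNode s x) t M
          simpa using this
      _ = _ := by
          rw [sum_const, card_univ, nsmul_eq_mul]
          simp only [Fintype.card_fun, Fintype.card_fin]
          push_cast
          ring
  have h1 := (card_le_card hcover).trans ((card_union_le _ _).trans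
    (Nat.add_le_add_left ((card_union_le _ _).trans
      (Nat.add_le_add card_biUnion_le card_biUnion_le)) _))
  have h2 : ((∑ v, #(B v) : ℕ) : ℝ) ≤ n * ((1 - (h : ℝ) / N) ^ K *
      ((N : ℝ) ^ K * (h : ℝ) ^ (K + 1))) := by
    push_cast
    refine (sum_le_sum fun v _ => hB v).trans ?_
    simp
  have h3 : ((∑ t ∈ range (T + 1), #(B' t) : ℕ) : ℝ) ≤ (T + 1) *
      (Real.exp (2 * (K + 1 : ℕ) / h - M / n) * ((N : ℝ) ^ K * (h : ℝ) ^ (K + 1))) := by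
    push_cast
    refine (sum_le_sum fun t _ => hB' t).trans ?_
    simp
  rw [card_univ] at h1
  have h4 : (Fintype.card Ω : ℝ) ≤ _ := Nat.cast_le.2 h1
  rw [hΩ] at h4
  push_cast at h2 h3 h4 ⊢
  linarith

end Probability

/-! ### Space and probability of success -/

section Bounds

variable {n p : ℕ}

/-- The number of bits of a node, and one more. -/
def logBits (n : ℕ) : ℕ := Nat.clog 2 n + 1

/-- `n / p`, rounded up. -/
def share (n p : ℕ) : ℕ := n / p + 1

lemma lt_two_pow_logBits (n : ℕ) : n < 2 ^ logBits n := by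
  have := Nat.le_pow_clog one_lt_two n
  have h2 := Nat.two_pow_pos (Nat.clog 2 n)
  rw [logBits, pow_succ]
  omega

lemma two_pow_clog_le (hn : 0 < n) : 2 ^ Nat.clog 2 n ≤ 2 * n := by
  rcases Nat.lt_or_ge 1 n with h | h
  · have h1 := Nat.pow_pred_clog_lt_self one_lt_two h
    have h2 : 0 < Nat.clog 2 n := Nat.clog_pos one_lt_two h
    have h3 : 2 ^ Nat.clog 2 n = 2 ^ (Nat.clog 2 n).pred * 2 := by
      rw [← pow_succ]; congr 1; simp only [Nat.pred_eq_sub_one]; omega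
    omega
  · obtain rfl : n = 1 := by omega
    simp

lemma logBits_le (hn : 0 < n) : (logBits n : ℝ) ≤ 2 * (1 + Real.log n) := by
  have hn' : (0 : ℝ) < n := by exact_mod_cast hn
  have h1 : (2 : ℝ) ^ Nat.clog 2 n ≤ 2 * n := by exact_mod_cast two_pow_clog_le hn
  have h2 := Real.log_le_log (by positivity) h1
  rw [Real.log_pow, Real.log_mul two_ne_zero hn'.ne'] at h2
  have h3 := Real.log_two_gt_d9
  have h4 : 0 ≤ Real.log n := Real.log_natCast_nonneg n
  rw [logBits]
  push_cast
  by_contra! h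
  nlinarith

lemma le_share_mul (hp : 0 < p) : n ≤ share n p * p := by
  have := Nat.lt_div_mul_add (a := n) hp
  rw [share, add_mul, one_mul]
  exact this.le

lemma share_le (hp : 0 < p) (hpn : p ≤ n) : (share n p : ℝ) ≤ 2 * (n / p) := by
  have hp' : (0 : ℝ) < p := by exact_mod_cast hp
  have h1 : ((n / p : ℕ) : ℝ) ≤ n / p := Nat.cast_div_le
  have h2 : (1 : ℝ) ≤ n / p := by
    rw [one_le_div hp']
    exact_mod_cast hpn
  rw [share]
  push_cast
  linarith

lemma le_share (hp : 0 < p) (hpn : p * p ≤ n) : p ≤ share n p :=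
  ((Nat.le_div_iff_mul_le hp).2 hpn).trans (Nat.le_succ _)

lemma storing_states_le (hp : 0 < p) (hpn : p ≤ n) :
    (p - 1) * n + (n * 2 ^ n ^ 2 + 2 ^ n ^ 2) ≤ 2 ^ (n ^ 2 + 3 * logBits n) := by
  have h1 := (lt_two_pow_logBits n).le
  set L := logBits n
  have h2 : 2 ≤ 2 ^ L := by
    calc 2 = 2 ^ 1 := rfl
      _ ≤ 2 ^ L := Nat.pow_le_pow_right two_pos (Nat.succ_le_succ (Nat.zero_le _))
  have h3 : 1 ≤ 2 ^ n ^ 2 := Nat.one_le_two_pow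
  have h4 : (p - 1) * n + n ≤ 2 ^ L * 2 ^ L := by
    calc (p - 1) * n + n ≤ n * n := by
          calc (p - 1) * n + n = (p - 1 + 1) * n := by ring
            _ ≤ n * n := Nat.mul_le_mul_right _ (by omega)
      _ ≤ _ := Nat.mul_le_mul h1 h1
  calc (p - 1) * n + (n * 2 ^ n ^ 2 + 2 ^ n ^ 2)
      ≤ ((p - 1) * n + n + 1) * 2 ^ n ^ 2 := by nlinarith [Nat.zero_le ((p - 1) * n)]
    _ ≤ (2 ^ L * 2 ^ L * 2 ^ L) * 2 ^ n ^ 2 := by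
        gcongr
        nlinarith [Nat.zero_le (2 ^ L)]
    _ = 2 ^ (n ^ 2 + 3 * L) := by ring

/-- Few passes: store the graph. -/
lemma exists_detAlgorithm_storing (hp : 0 < p) (hpn : p ≤ n) :
    ∃ A : DetAlgorithm n (n ^ 2 + 3 * logBits n) (Update n), ∀ G : SimpleGraph (Fin n),
      G.Connected → ∀ s σ, IsTurnstileStream G σ → IsBFSTree G s (A.run p s σ) :=
  (findsBFSTree_of_storing (fun i : RootedGraph n => i.2.2) hp).exists_detAlgorithm
    (hp.trans_le hpn) (storing_states_le hp hpn)

lemma layers_states_le {T d ℓ q L : ℕ} (hnL : n + 1 ≤ 2 ^ L) (hT : T ≤ 2 ^ L)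
    (hℓ : ℓ + 1 ≤ 2 ^ L) (hq : q ≤ 2 ^ L) (hq0 : 0 < q) (hL : 1 ≤ L) :
    T * (n * (n + 1) ^ n * ((q ^ (2 * d)) ^ n * (q ^ n * q ^ n))) +
        (ℓ * q ^ n + 1) * (n * n ^ n * n ^ n) ≤ 2 ^ (L * (3 + 3 * n + 2 * d * n)) := by
  have hnL' : n ≤ 2 ^ L := by omega
  have h1 : T * (n * (n + 1) ^ n * ((q ^ (2 * d)) ^ n * (q ^ n * q ^ n)))
      ≤ 2 ^ (L * (2 + 3 * n + 2 * d * n)) := by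
    calc _ ≤ 2 ^ L * (2 ^ L * (2 ^ L) ^ n * (((2 ^ L) ^ (2 * d)) ^ n * ((2 ^ L) ^ n * (2 ^ L) ^ n))) := by
          gcongr
      _ = _ := by ring
  have h2 : (ℓ * q ^ n + 1) * (n * n ^ n * n ^ n) ≤ 2 ^ (L * (2 + 3 * n)) := by
    have : ℓ * q ^ n + 1 ≤ (ℓ + 1) * q ^ n := by
      have : 1 ≤ q ^ n := Nat.one_le_pow _ _ hq0
      linarith
    calc _ ≤ (2 ^ L * (2 ^ L) ^ n) * (2 ^ L * (2 ^ L) ^ n * (2 ^ L) ^ n) := by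
          gcongr
          exact this.trans (by gcongr)
      _ = _ := by ring
  have h3 : 2 ^ (L * (2 + 3 * n)) ≤ 2 ^ (L * (2 + 3 * n + 2 * d * n)) :=
    Nat.pow_le_pow_right two_pos (Nat.mul_le_mul_left _ (by omega))
  have h4 : 2 * 2 ^ (L * (2 + 3 * n + 2 * d * n)) ≤ 2 ^ (L * (3 + 3 * n + 2 * d * n)) := by
    rw [← pow_succ']
    exact Nat.pow_le_pow_right two_pos (by nlinarith)
  omega

/-- The deterministic algorithm, in `p` passes. -/
lemma exists_detAlgorithm (hp : 0 < p) (hpn : p * p ≤ n) :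
    ∃ S ≤ 20 * logBits n * (n * share n p), ∃ A : DetAlgorithm n S (Update n),
      ∀ G : SimpleGraph (Fin n), G.Connected → ∀ s σ, IsTurnstileStream G σ →
        IsBFSTree G s (A.run p s σ) := by
  have hpn' : p ≤ n := (Nat.le_mul_of_pos_left p hp).trans hpn
  have hn : 0 < n := hp.trans_le hpn'
  have hap := le_share_mul (n := n) hp
  have hL : 1 ≤ logBits n := Nat.succ_le_succ (Nat.zero_le _)
  have hL2 := lt_two_pow_logBits n
  have ha : 1 ≤ share n p := Nat.succ_le_succ (Nat.zero_le _)
  have hna : 1 ≤ n * share n p := Nat.mul_pos hn ha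
  have hℓ : Nat.clog 2 n + 1 = logBits n := rfl
  set L := logBits n
  set a := share n p
  -- With so few passes n^2 exceeds the target by no more than a logarithm, and storing the graph is
  -- affordable. Otherwise the passes for the parents take less than half of p.
  by_cases hsmall : p < 16 * L
  · refine ⟨n ^ 2 + 3 * L, ?_, exists_detAlgorithm_storing hp hpn'⟩
    have h1 : n ^ 2 ≤ 16 * L * (n * a) := by
      calc n ^ 2 = n * n := sq n
        _ ≤ n * (a * (16 * L)) := Nat.mul_le_mul_left _ (hap.trans (Nat.mul_le_mul_left _ hsmall.le))
        _ = _ := by ring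
    have h2 : 3 * L ≤ 3 * L * (n * a) := Nat.le_mul_of_pos_right _ hna
    nlinarith
  · push Not at hsmall
    obtain ⟨q, hq, hnq, hq2⟩ := Nat.exists_prime_lt_and_le_two_mul n hn.ne'
    have : Fact q.Prime := ⟨hq⟩
    -- At least p/2 passes remain for the layers and a * p ≥ n, so the threshold 6a yields at least
    -- 3n; the summand 1 makes the inequality strict.
    have hT : n * 3 < (p - Nat.clog 2 n) * (6 * a + 1) := by
      have h1 : p ≤ 2 * (p - Nat.clog 2 n) := by omega
      have h2 : a * p ≤ a * (2 * (p - Nat.clog 2 n)) := Nat.mul_le_mul_left _ h1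
      have h3 : 0 < p - Nat.clog 2 n := by omega
      nlinarith
    have h := findsBFSTree_by_layers (src := fun i : RootedGraph n => i.1) hn (fun i => i.2.2) hnq
      (Nat.le_pow_clog one_lt_two n) hT
    rw [Nat.sub_add_cancel (by omega)] at h
    have hq2' : q ≤ 2 ^ L := by
      have := Nat.le_pow_clog one_lt_two n
      rw [← hℓ, pow_succ]
      omega
    refine ⟨L * (3 + 3 * n + 2 * (6 * a) * n), ?_, h.exists_detAlgorithm hn
      (layers_states_le hL2 (by omega) (hℓ ▸ Nat.lt_two_pow_self.le) hq2' hq.pos hL)⟩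
    have : n ≤ n * a := Nat.le_mul_of_pos_right _ ha
    calc L * (3 + 3 * n + 2 * (6 * a) * n) ≤ L * (20 * (n * a)) :=
          Nat.mul_le_mul_left _ (by nlinarith)
      _ = _ := by ring

lemma exists_randAlgorithm_of_det {S : ℕ} (A : DetAlgorithm n S (Update n)) :
    ∃ A' : RandAlgorithm n S (Update n), ∀ p s σ, A'.run p s σ = PMF.pure (A.run p s σ) := by
  refine ⟨RandAlgorithm.ofInit A (r := 0) fun s _ => A.init s, fun p s σ => ?_⟩
  rw [RandAlgorithm.run_ofInit]
  exact PMF.map_const _ _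

lemma sweepStates_le {B K r M T ℓ q μ : ℕ} (hB : B ≤ 2 ^ r) (hnμ : n + 1 ≤ 2 ^ μ)
    (hT : T ≤ 2 ^ μ) (hℓ : ℓ + 1 ≤ 2 ^ μ) (hq : q ≤ 2 ^ μ) (hq0 : 0 < q)
    (hK : K * n + 1 ≤ 2 ^ μ) :
    sweepStates n B K M T ℓ q
      ≤ 3 * 2 ^ (r + μ * (2 + K + K * K + 3 * n + 8 * M)) := by
  have hnμ' : n ≤ 2 ^ μ := by omega
  have h1 : T * (B * ((n + 1) ^ K) ^ K * (K * n + 1) ^ M * (K * n + 1) ^ M * q ^ (2 * (3 * M)))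
      ≤ 2 ^ (r + μ * (2 + K + K * K + 3 * n + 8 * M)) := by
    calc _ ≤ 2 ^ μ * (2 ^ r * ((2 ^ μ) ^ K) ^ K * (2 ^ μ) ^ M * (2 ^ μ) ^ M *
          (2 ^ μ) ^ (2 * (3 * M))) := by gcongr
      _ = 2 ^ (r + μ * (1 + K * K + 8 * M)) := by ring
      _ ≤ _ := Nat.pow_le_pow_right two_pos
          (Nat.add_le_add_left (Nat.mul_le_mul_left _ (by omega)) _)
  have h2 : T * (B * n ^ K * (n + 1) ^ n * (K * n + 1) ^ M * (K * n + 1) ^ M * q ^ (2 * (3 * M)))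
      ≤ 2 ^ (r + μ * (2 + K + K * K + 3 * n + 8 * M)) := by
    calc _ ≤ 2 ^ μ * (2 ^ r * (2 ^ μ) ^ K * (2 ^ μ) ^ n * (2 ^ μ) ^ M * (2 ^ μ) ^ M *
          (2 ^ μ) ^ (2 * (3 * M))) := by gcongr
      _ = 2 ^ (r + μ * (1 + K + n + 8 * M)) := by ring
      _ ≤ _ := Nat.pow_le_pow_right two_pos
          (Nat.add_le_add_left (Nat.mul_le_mul_left _ (by omega)) _)
  have h3 : (ℓ * q ^ n + 1) * (n * n ^ n * n ^ n)
      ≤ 2 ^ (r + μ * (2 + K + K * K + 3 * n + 8 * M)) := by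
    have : ℓ * q ^ n + 1 ≤ (ℓ + 1) * q ^ n := by
      have : 1 ≤ q ^ n := Nat.one_le_pow _ _ hq0
      linarith
    calc _ ≤ (2 ^ μ * (2 ^ μ) ^ n) * (2 ^ μ * (2 ^ μ) ^ n * (2 ^ μ) ^ n) := by
          gcongr
          exact this.trans (by gcongr)
      _ = 2 ^ (μ * (2 + 3 * n)) := by ring
      _ ≤ _ := Nat.pow_le_pow_right two_pos
          (le_add_left (Nat.mul_le_mul_left _ (by omega)))
  rw [sweepStates]
  omega

lemma exp_neg_le (hn : 0 < n) (k : ℕ) :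
    Real.exp (-(k * logBits n : ℕ)) ≤ (1 / (2 * n)) ^ k := by
  have hn' : (0 : ℝ) < n := by exact_mod_cast hn
  have h1 : (2 * n : ℝ) ≤ Real.exp (logBits n) := by
    have h2 : (2 * n : ℝ) ≤ 2 ^ logBits n := by
      have := Nat.le_pow_clog one_lt_two n
      rw [logBits, pow_succ, mul_comm]
      exact_mod_cast Nat.mul_le_mul_right 2 this
    refine h2.trans ?_
    have h3 : (2 : ℝ) ≤ Real.exp 1 := by linarith [Real.exp_one_gt_d9]
    calc (2 : ℝ) ^ logBits n ≤ Real.exp 1 ^ logBits n := by gcongr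
      _ = Real.exp (logBits n) := by rw [← Real.exp_nat_mul, mul_one]
  rw [Real.exp_neg, Nat.cast_mul, Real.exp_nat_mul, one_div, inv_pow]
  gcongr

lemma failure_le (hn : 0 < n) (c : ℕ) :
    n * (1 / (2 * n : ℝ)) ^ (c + 2) + n * (1 / (2 * n : ℝ)) ^ (c + 2) ≤ 1 / (n : ℝ) ^ c := by
  have hn' : (1 : ℝ) ≤ n := by exact_mod_cast hn
  have h1 : n * (1 / (2 * n : ℝ)) ^ (c + 2) + n * (1 / (2 * n : ℝ)) ^ (c + 2)
      = (1 / (2 * n)) ^ c * (1 / (2 * n)) := by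
    rw [pow_add]; field_simp; ring
  rw [h1]
  have h2 : (1 / (2 * n : ℝ)) ≤ 1 := by
    rw [div_le_one (by positivity)]; linarith
  calc (1 / (2 * n : ℝ)) ^ c * (1 / (2 * n)) ≤ (1 / (2 * n)) ^ c := mul_le_of_le_one_right
        (by positivity) h2
    _ ≤ (1 / n) ^ c := by gcongr; linarith
    _ = 1 / (n : ℝ) ^ c := by rw [div_pow, one_pow]

open Classical in
/-- With enough starting nodes and large enough bounds for the frontiers, most seeds are good. -/
lemma le_card_goodSeed_of_le {K h T M c : ℕ} (hh : 0 < h) (hT : T + 1 ≤ n)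
    (hhn : h ≤ n)
    (hK : (c + 2) * logBits n * 2 ^ Nat.clog 2 n ≤ K * h)
    (hM : n * (2 * (K + 1) / h + 1 + (c + 2) * logBits n) ≤ M)
    {G : SimpleGraph (Fin n)} (hG : G.Connected) (s : Fin n) :
    (1 - 1 / (n : ℝ) ^ c) * (((2 ^ Nat.clog 2 n : ℕ) : ℝ) ^ K * (h : ℝ) ^ (K + 1)) ≤
      (#{ω : (Fin K → Fin (2 ^ Nat.clog 2 n)) × (Option (Fin K) → Fin h) |
        GoodSeed T M G s ω} : ℝ) := by
  have hn : 0 < n := by omega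
  have hn' : (0 : ℝ) < n := by exact_mod_cast hn
  have hh' : (0 : ℝ) < h := by exact_mod_cast hh
  have hnN := Nat.le_pow_clog one_lt_two n
  set N := 2 ^ Nat.clog 2 n with hN
  have hN' : (0 : ℝ) < N := by exact_mod_cast hn.trans_le hnN
  refine le_trans ?_ (le_card_goodSeed T M hn hh hnN (hhn.trans hnN) hG s)
  refine mul_le_mul_of_nonneg_right ?_ (by positivity)
  have h1 : (1 - (h : ℝ) / N) ^ K ≤ (1 / (2 * n)) ^ (c + 2) := by
    refine le_trans ?_ (exp_neg_le hn (c + 2))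
    have h2 : (h : ℝ) / N ≤ 1 := by
      rw [div_le_one hN']
      exact_mod_cast hhn.trans hnN
    calc (1 - (h : ℝ) / N) ^ K ≤ Real.exp (-(h / N)) ^ K :=
          pow_le_pow_left₀ (by linarith) (Real.one_sub_le_exp_neg _) _
      _ = Real.exp (-(K * h / N)) := by rw [← Real.exp_nat_mul]; congr 1; ring
      _ ≤ _ := by
        rw [Real.exp_le_exp, neg_le_neg_iff, le_div_iff₀ hN']
        exact_mod_cast hK
  have h2 : Real.exp (2 * (K + 1 : ℕ) / h - M / n) ≤ (1 / (2 * n)) ^ (c + 2) := by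
    refine le_trans ?_ (exp_neg_le hn (c + 2))
    rw [Real.exp_le_exp]
    have h3 : (2 * (K + 1 : ℕ) / h : ℝ) ≤ (2 * (K + 1) / h + 1 : ℕ) := by
      rw [div_le_iff₀ hh']
      have := (Nat.lt_div_mul_add (a := 2 * (K + 1)) hh).le
      rw [← Nat.succ_mul] at this
      exact_mod_cast this
    have h4 : ((2 * (K + 1) / h + 1 + (c + 2) * logBits n : ℕ) : ℝ) ≤ M / n := by
      rw [le_div_iff₀ hn', mul_comm]
      exact_mod_cast hM
    push_cast at h3 h4 ⊢
    linarith
  have h5 : ((T : ℝ) + 1) * Real.exp (2 * (K + 1 : ℕ) / h - M / n)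
      ≤ n * (1 / (2 * n)) ^ (c + 2) := by
    refine mul_le_mul ?_ h2 (Real.exp_pos _).le hn'.le
    exact_mod_cast hT
  have h6 : n * (1 - (h : ℝ) / N) ^ K ≤ n * (1 / (2 * n)) ^ (c + 2) :=
    mul_le_mul_of_nonneg_left h1 hn'.le
  have := failure_le hn c
  linarith

end Bounds

/-! ### Choice of the parameters of the randomized algorithm -/

section Main

variable {n p : ℕ}

/-- A power of two close to `p / 8`. -/
lemma exists_two_pow_le_div (hp : 8 ≤ p) : ∃ b, 8 * 2 ^ b ≤ p ∧ p ≤ 16 * 2 ^ b := by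
  refine ⟨Nat.log 2 (p / 8), ?_, ?_⟩
  · have := Nat.pow_log_le_self 2 (x := p / 8) (by omega)
    omega
  · have := Nat.lt_pow_succ_log_self one_lt_two (p / 8)
    rw [pow_succ] at this
    omega

open Classical in
/-- The randomized algorithm with explicit parameters. -/
lemma exists_randAlgorithm_of_params {K b M T c q S r : ℕ}
    (hT : T = 2 * 2 ^ b) (hTn : T + 1 ≤ n) (hTp : T + (T + Nat.clog 2 n) ≤ p)
    (hK : (c + 2) * logBits n * 2 ^ Nat.clog 2 n ≤ K * 2 ^ b)
    (hM : n * (2 * (K + 1) / 2 ^ b + 1 + (c + 2) * logBits n) ≤ M)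
    (hq : q.Prime) (hnq : n < q) (hKq : (K + 1) * n ≤ q)
    (hr : r = Nat.clog 2 n * K + b * (K + 1))
    (hS : p * (n * 2 ^ r) + sweepStates n (n * 2 ^ r) (K + 1) M T (Nat.clog 2 n) q ≤ 2 ^ S) :
    ∃ A : RandAlgorithm n S (Update n), ∀ G : SimpleGraph (Fin n), G.Connected → ∀ s σ,
      IsTurnstileStream G σ → 1 - 1 / (n : ℝ) ^ c ≤
        ((A.run p s σ).toOuterMeasure {T | IsBFSTree G s T}).toReal := by
  have hn : 0 < n := by omega
  have hh : 0 < 2 ^ b := Nat.two_pow_pos b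
  have : Fact q.Prime := ⟨hq⟩
  let Ω := (Fin K → Fin (2 ^ Nat.clog 2 n)) × (Option (Fin K) → Fin (2 ^ b))
  have hΩ : Fintype.card (Fin r → Bool) = Fintype.card Ω := by
    simp only [Ω, Fintype.card_fun, Fintype.card_bool, Fintype.card_fin, Fintype.card_prod,
      Fintype.card_option, hr, pow_add, pow_mul]
  let e : (Fin r → Bool) ≃ Ω := Fintype.equivOfCardEq hΩ
  -- All counts of choices are powers of two, so r coins encode a seed exactly and uniformly.
  let good : (Fin r → Bool) → RootedGraph n → Prop := fun ω i => GoodSeed T M i.2.1 i.1 (e ω)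
  have h := findsBFSTree_by_sweeps (I := SeededGraph n r good) (g := fun i => i.1.2.2.1)
    (src := fun i => i.1.2.1) hn (fun i => i.1.2.2.2) (Nat.le_pow_clog one_lt_two n) hnq
    (ι := Option (Fin K)) (by simpa using hKq) (h := 2 ^ b) (M := M) (T := T)
    (fun i => (i.1.2.1, i.1.1)) (fun i => startNode i.1.2.1 (e i.1.1).1)
    (fun i j => (e i.1.1).2 j) (fun i j hij => by rw [(Prod.mk.inj hij).1, (Prod.mk.inj hij).2])
    (fun i j hij => by rw [(Prod.mk.inj hij).2]) (fun i j hij => (Prod.mk.inj hij).1)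
    none (fun i => rfl) (fun i j => by have := ((e i.1.1).2 j).2; omega)
    (fun i => i.2.1) (fun i => i.2.2)
  have h2 := (h.idle hTp).mono (N' := 2 ^ S) (by
    refine le_trans ?_ hS
    simp only [Fintype.card_prod, Fintype.card_fin, Fintype.card_fun, Fintype.card_bool,
      Fintype.card_option]
    gcongr
    omega)
  obtain ⟨A, hA⟩ := h2.exists_randAlgorithm hn le_rfl good
  refine ⟨A, fun G hG s σ hσ => le_trans ?_ (hA G hG s σ hσ)⟩
  rw [le_div_iff₀ (by positivity)]
  have h3 := le_card_goodSeed_of_le hh hTn (by omega) hK hM hG s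
  have h4 : #{ω : Ω | GoodSeed T M G s ω} = #{ω | good ω (s, ⟨G, hG⟩)} := by
    symm
    refine card_bij (fun ω _ => e ω) ?_ (fun _ _ _ _ h => e.injective h) ?_
    · intro ω hω
      exact mem_filter.2 ⟨mem_univ _, (mem_filter.1 hω).2⟩
    · intro ω hω
      refine ⟨e.symm ω, mem_filter.2 ⟨mem_univ _, ?_⟩, e.apply_symm_apply ω⟩
      simpa [good] using (mem_filter.1 hω).2
  rw [h4] at h3
  refine le_trans (le_of_eq ?_) h3
  rw [hr]
  push_cast
  rw [pow_add, pow_mul, pow_mul]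

/-- The main terms are K^2 (distances between starting nodes) and M (frontiers); `hna`, which comes
from p ≤ √n, absorbs the terms linear in n. -/
lemma space_le {c L a K M r : ℕ} (hL : 1 ≤ L) (ha : 1 ≤ a) (hna : n ≤ a ^ 2)
    (hK : K + 1 ≤ 40 * (c + 2) * L * a) (hM : M ≤ 1300 * (c + 2) * L * a ^ 2)
    (hr : r ≤ 2 * ((c + 6) * L * (K + 1))) :
    (c + 6) * L + r + (c + 6) * L * (2 + (K + 1) + (K + 1) * (K + 1) + 3 * n + 8 * M) + 2 ≤
      30000 * (c + 6) ^ 3 * L ^ 3 * a ^ 2 := by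
  have hμ : 1 ≤ (c + 6) * L := Nat.mul_pos (Nat.succ_pos _) hL
  have hx : 1 ≤ (c + 2) * L * a := Nat.mul_pos (Nat.mul_pos (Nat.succ_pos _) hL) ha
  have hsq : (c + 2) * L * a ≤ ((c + 2) * L * a) ^ 2 := Nat.le_self_pow two_ne_zero _
  have h3 : K + 1 ≤ 40 * ((c + 2) * L * a) := hK.trans (le_of_eq (by ring))
  have h4 : (K + 1) * (K + 1) ≤ 1600 * ((c + 2) * L * a) ^ 2 :=
    (Nat.mul_le_mul h3 h3).trans (le_of_eq (by ring))
  have h5 : a ^ 2 ≤ ((c + 2) * L * a) ^ 2 :=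
    Nat.pow_le_pow_left (Nat.le_mul_of_pos_left _ (Nat.mul_pos (Nat.succ_pos _) hL)) 2
  have h7 : M ≤ 1300 * ((c + 2) * L * a) ^ 2 := by
    calc M ≤ 1300 * (((c + 2) * L) * a ^ 2) := hM.trans (le_of_eq (by ring))
      _ ≤ 1300 * (((c + 2) * L) ^ 2 * a ^ 2) := by
        gcongr
        exact Nat.le_self_pow two_ne_zero _
      _ = _ := by ring
  have h8 : 5 + 2 * (K + 1) + (2 + (K + 1) + (K + 1) * (K + 1) + 3 * n + 8 * M)
      ≤ 30000 * ((c + 2) * L * a) ^ 2 := by omega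
  calc _ ≤ (c + 6) * L * (5 + 2 * (K + 1) +
        (2 + (K + 1) + (K + 1) * (K + 1) + 3 * n + 8 * M)) := by
        generalize (2 + (K + 1) + (K + 1) * (K + 1) + 3 * n + 8 * M) = E
        generalize (c + 6) * L = μ at *
        calc μ + r + μ * E + 2 ≤ μ + 2 * (μ * (K + 1)) + μ * E + 2 * μ := by omega
          _ ≤ μ * (5 + 2 * (K + 1) + E) := by
            have : μ * (5 + 2 * (K + 1) + E) = μ + 2 * (μ * (K + 1)) + μ * E + 2 * μ + 2 * μ := by
              ring
            omega
    _ ≤ (c + 6) * L * (30000 * ((c + 2) * L * a) ^ 2) := Nat.mul_le_mul_left _ h8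
    _ ≤ (c + 6) * L * (30000 * ((c + 6) * L * a) ^ 2) := by gcongr; norm_num
    _ = _ := by ring

/-- The randomized algorithm, in `p` passes. -/
lemma exists_randAlgorithm (c : ℕ) (hp : 0 < p) (hpn : p * p ≤ n) :
    ∃ S ≤ 30000 * (c + 6) ^ 3 * logBits n ^ 3 * share n p ^ 2,
      ∃ A : RandAlgorithm n S (Update n), ∀ G : SimpleGraph (Fin n), G.Connected → ∀ s σ,
        IsTurnstileStream G σ → 1 - 1 / (n : ℝ) ^ c ≤
          ((A.run p s σ).toOuterMeasure {T | IsBFSTree G s T}).toReal := by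
  have hpn' : p ≤ n := (Nat.le_mul_of_pos_left p hp).trans hpn
  have hn : 0 < n := hp.trans_le hpn'
  have hap := le_share_mul (n := n) hp
  have hpa := le_share hp hpn
  have hL : 1 ≤ logBits n := Nat.succ_le_succ (Nat.zero_le _)
  have hnL := lt_two_pow_logBits n
  have ha : 1 ≤ share n p := Nat.succ_le_succ (Nat.zero_le _)
  have hℓ : Nat.clog 2 n + 1 = logBits n := rfl
  have hna : n ≤ share n p ^ 2 := hap.trans (by rw [sq]; exact Nat.mul_le_mul_left _ hpa)
  have hN2 := two_pow_clog_le hn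
  set L := logBits n
  set a := share n p
  have hLa : 1 ≤ L * a := Nat.mul_pos hL ha
  by_cases hsmall : p < 16 * L
  · obtain ⟨A, hA⟩ := exists_detAlgorithm_storing hp hpn'
    obtain ⟨A', hA'⟩ := exists_randAlgorithm_of_det A
    refine ⟨n ^ 2 + 3 * L, ?_, A', fun G hG s σ hσ => ?_⟩
    · have h1 : n ≤ 16 * (L * a) := (hap.trans (Nat.mul_le_mul_left _ hsmall.le)).trans
        (le_of_eq (by ring))
      have h2 : L ≤ (L * a) ^ 2 := by nlinarith [Nat.le_mul_of_pos_right L ha]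
      calc n ^ 2 + 3 * L ≤ (16 * (L * a)) ^ 2 + 3 * (L * a) ^ 2 := by gcongr
        _ = 259 * 1 * L ^ 2 * a ^ 2 := by ring
        _ ≤ 30000 * (c + 6) ^ 3 * L ^ 3 * a ^ 2 := by
          gcongr
          · norm_num
          · exact Nat.one_le_pow _ _ (by omega)
          · norm_num
    · have hmem : A.run p s σ ∈ {T | IsBFSTree G s T} := hA G hG s σ hσ
      rw [hA', PMF.toOuterMeasure_pure_apply, if_pos hmem]
      have : 0 ≤ 1 / (n : ℝ) ^ c := by positivity
      simp only [ENNReal.toReal_one]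
      linarith
  push Not at hsmall
  -- Two sweeps of 2h passes with h ≤ p/8 use at most half of the passes; the parents need fewer
  -- than p/16.
  obtain ⟨b, hb1, hb2⟩ := exists_two_pow_le_div (p := p) (by omega)
  have hh : 0 < 2 ^ b := Nat.two_pow_pos b
  set h := 2 ^ b with hh'
  -- Chosen so that K h / N is at least (c + 2) L: a fixed end node is then missed with probability
  -- at most (1/(2n))^(c+2).
  obtain ⟨K, hK⟩ : ∃ K, K = (c + 2) * L * (2 ^ Nat.clog 2 n / h + 1) := ⟨_, rfl⟩
  obtain ⟨M, hM⟩ : ∃ M, M = n * (2 * (K + 1) / h + 1 + (c + 2) * L) := ⟨_, rfl⟩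
  -- Power sums need a distinct element of the field for each of the (K + 1) n pairs of a search and
  -- a node.
  obtain ⟨q, hq, hq1, hq2⟩ := Nat.exists_prime_lt_and_le_two_mul ((K + 1) * n)
    (Nat.mul_pos (Nat.succ_pos _) hn).ne'
  have hnK : n ≤ (K + 1) * n := Nat.le_mul_of_pos_left _ (Nat.succ_pos _)
  -- bounds for the parameters
  have hN : 2 ^ Nat.clog 2 n ≤ 32 * a * h := by
    calc 2 ^ Nat.clog 2 n ≤ 2 * (a * (16 * h)) :=
          hN2.trans (Nat.mul_le_mul_left _ (hap.trans (Nat.mul_le_mul_left _ hb2)))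
      _ = 32 * a * h := by ring
  have hKle : K + 1 ≤ 40 * (c + 2) * L * a := by
    have h1 : 2 ^ Nat.clog 2 n / h ≤ 32 * a := Nat.div_le_of_le_mul (by linarith)
    have h2 : K ≤ (c + 2) * L * (33 * a) := by
      rw [hK]
      exact Nat.mul_le_mul_left _ (by omega)
    nlinarith
  have hMle : M ≤ 1300 * (c + 2) * L * a ^ 2 := by
    have h1 : n * (2 * (K + 1) / h) ≤ 32 * a * (K + 1) := by
      calc n * (2 * (K + 1) / h) ≤ a * (16 * h) * (2 * (K + 1) / h) :=
            Nat.mul_le_mul_right _ (hap.trans (Nat.mul_le_mul_left _ hb2))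
        _ = 16 * a * (h * (2 * (K + 1) / h)) := by ring
        _ ≤ 16 * a * (2 * (K + 1)) := Nat.mul_le_mul_left _ (Nat.mul_div_le _ _)
        _ = 32 * a * (K + 1) := by ring
    calc M = n * (2 * (K + 1) / h) + n * (1 + (c + 2) * L) := by rw [hM]; ring
      _ ≤ 32 * a * (40 * (c + 2) * L * a) + a ^ 2 * ((c + 2) * L + (c + 2) * L) := by
        refine Nat.add_le_add (h1.trans (Nat.mul_le_mul_left _ hKle)) (Nat.mul_le_mul hna ?_)
        exact Nat.add_le_add_right (Nat.mul_pos (Nat.succ_pos _) hL) _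
      _ = 1282 * (c + 2) * L * a ^ 2 := by ring
      _ ≤ _ := by gcongr; norm_num
  obtain ⟨μ, hμ⟩ : ∃ μ, μ = (c + 6) * L := ⟨_, rfl⟩
  have hLμ : L ≤ μ := hμ ▸ Nat.le_mul_of_pos_left _ (by omega)
  have hqμ : 2 * ((K + 1) * n) ≤ 2 ^ μ := by
    have h1 : 2 ^ Nat.clog 2 n / h + 1 ≤ 2 ^ L := by
      have h2 := Nat.div_le_self (2 ^ Nat.clog 2 n) h
      have h3 : 2 ^ L = 2 ^ Nat.clog 2 n * 2 := by rw [← hℓ, pow_succ]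
      have h4 := Nat.two_pow_pos (Nat.clog 2 n)
      omega
    have h2 : K + 1 ≤ 2 ^ (c + 2) * 2 ^ L * 2 ^ L := by
      rw [hK]
      refine Nat.succ_le_of_lt ?_
      calc (c + 2) * L * (2 ^ Nat.clog 2 n / h + 1) ≤ (c + 2) * L * 2 ^ L := by gcongr
        _ < 2 ^ (c + 2) * 2 ^ L * 2 ^ L := by
          refine Nat.mul_lt_mul_of_pos_right ?_ (Nat.two_pow_pos _)
          exact Nat.mul_lt_mul'' Nat.lt_two_pow_self Nat.lt_two_pow_self
    calc 2 * ((K + 1) * n) ≤ 2 * ((2 ^ (c + 2) * 2 ^ L * 2 ^ L) * 2 ^ L) := by gcongr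
      _ = 2 ^ (c + 3 + 3 * L) := by ring
      _ ≤ 2 ^ μ := by
        refine Nat.pow_le_pow_right two_pos ?_
        rw [hμ]
        nlinarith [Nat.le_mul_of_pos_right c hL]
  have hKn1 : 1 ≤ (K + 1) * n := Nat.mul_pos (Nat.succ_pos _) hn
  have hnμ : n + 1 ≤ 2 ^ μ := by omega
  obtain ⟨r, hr⟩ : ∃ r, r = Nat.clog 2 n * K + b * (K + 1) := ⟨_, rfl⟩
  have hrle : r ≤ 2 * (μ * (K + 1)) := by
    have h1 : b ≤ μ := by
      have h2 : b < h := Nat.lt_two_pow_self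
      have h3 : 2 ^ b < 2 ^ L := by
        refine lt_of_le_of_lt ?_ hnL
        omega
      exact ((Nat.pow_lt_pow_iff_right one_lt_two).1 h3).le.trans hLμ
    have h2 : Nat.clog 2 n ≤ μ := by omega
    calc r = Nat.clog 2 n * K + b * (K + 1) := hr
      _ ≤ μ * (K + 1) + μ * (K + 1) := by
        gcongr
        omega
      _ = _ := by ring
  have hB : n * 2 ^ r ≤ 2 ^ (μ + r) := by
    rw [pow_add]
    exact Nat.mul_le_mul_right _ (by omega)
  have hst := sweepStates_le (n := n) (B := n * 2 ^ r) (K := K + 1) (r := μ + r) (M := M)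
    (T := 2 * h) (ℓ := Nat.clog 2 n) (q := q) (μ := μ) hB hnμ (by omega)
    (hℓ ▸ hLμ.trans Nat.lt_two_pow_self.le) (hq2.trans hqμ) hq.pos (by omega)
  obtain ⟨E, hE⟩ : ∃ E, E = 2 + (K + 1) + (K + 1) * (K + 1) + 3 * n + 8 * M := ⟨_, rfl⟩
  rw [← hE] at hst
  refine ⟨μ + r + μ * E + 2, ?_, exists_randAlgorithm_of_params (K := K) (b := b) (M := M) (c := c)
    (q := q) (r := r) rfl (by omega) (by omega) ?_ hM.ge hq (by omega) hq1.le hr ?_⟩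
  · rw [hμ] at hrle ⊢
    exact hE ▸ space_le hL ha hna hKle hMle hrle
  · calc (c + 2) * L * 2 ^ Nat.clog 2 n ≤ (c + 2) * L * ((2 ^ Nat.clog 2 n / h + 1) * h) := by
          gcongr
          rw [add_mul, one_mul]
          exact (Nat.lt_div_mul_add hh).le
      _ = K * h := by rw [hK]; ring
  · have h1 : p * (n * 2 ^ r) ≤ 2 ^ (μ + r + μ * E) := by
      calc p * (n * 2 ^ r) ≤ 2 ^ μ * 2 ^ (μ + r) := by
            gcongr
            omega
        _ = 2 ^ (μ + r + μ * 1) := by ring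
        _ ≤ _ := Nat.pow_le_pow_right two_pos
          (Nat.add_le_add_left (Nat.mul_le_mul_left _ (by omega)) _)
    have h2 : 2 ^ (μ + r + μ * E + 2) = 4 * 2 ^ (μ + r + μ * E) := by ring
    rw [h2]
    linarith

end Main

end GraphStream

/-! ### The two bounds in terms of n/p and log n -/

theorem theorem3 :
    -- turnstile model, randomized, `p` passes, space `Õ((n/p)^2)`
    (∀ c : ℕ, ∃ (C : ℝ) (k : ℕ), ∀ n p : ℕ, 1 ≤ p → (p : ℝ) ≤ Real.sqrt n →
      ∃ S : ℕ, (S : ℝ) ≤ C * ((n : ℝ) / p) ^ 2 * (1 + Real.log n) ^ k ∧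
        ∃ A : GraphStream.RandAlgorithm n S (GraphStream.Update n),
          ∀ G : SimpleGraph (Fin n), G.Connected → ∀ (s : Fin n) (σ : List (GraphStream.Update n)),
            GraphStream.IsTurnstileStream G σ →
              1 - 1 / (n : ℝ) ^ c ≤
                ((A.run p s σ).toOuterMeasure {T | GraphStream.IsBFSTree G s T}).toReal) ∧
    -- insertion-only model, deterministic, `p` passes, space `Õ(n^2/p)`
    (∃ (C : ℝ) (k : ℕ), ∀ n p : ℕ, 1 ≤ p → (p : ℝ) ≤ Real.sqrt n →
      ∃ S : ℕ, (S : ℝ) ≤ C * ((n : ℝ) ^ 2 / p) * (1 + Real.log n) ^ k ∧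
        ∃ A : GraphStream.DetAlgorithm n S (Sym2 (Fin n)),
          ∀ G : SimpleGraph (Fin n), G.Connected → ∀ (s : Fin n) (σ : List (Sym2 (Fin n))),
            GraphStream.IsInsertionStream G σ →
              GraphStream.IsBFSTree G s (A.run p s σ)) := by
  have hsq : ∀ n p : ℕ, (p : ℝ) ≤ Real.sqrt n → p * p ≤ n := by
    intro n p h
    rcases Nat.eq_zero_or_pos p with rfl | hp
    · simp
    · rw [Real.le_sqrt' (by exact_mod_cast hp), sq] at h
      exact_mod_cast h
  refine ⟨fun c => ⟨(30000 * (c + 6) ^ 3 * 2 ^ 3 * 2 ^ 2 : ℝ), 3, fun n p hp h => ?_⟩,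
    20 * 2 * 2, 1, fun n p hp h => ?_⟩
  · have hpn := hsq n p h
    have hpn' : p ≤ n := (Nat.le_mul_of_pos_left p hp).trans hpn
    obtain ⟨S, hS, A, hA⟩ := GraphStream.exists_randAlgorithm c hp hpn
    refine ⟨S, ?_, A, hA⟩
    calc (S : ℝ) ≤ 30000 * (c + 6) ^ 3 * GraphStream.logBits n ^ 3 * GraphStream.share n p ^ 2 := by exact_mod_cast hS
      _ ≤ 30000 * (c + 6) ^ 3 * (2 * (1 + Real.log n)) ^ 3 * (2 * (n / p)) ^ 2 := by
        gcongr
        · exact GraphStream.logBits_le (by omega)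
        · exact GraphStream.share_le hp hpn'
      _ = _ := by ring
  · have hpn := hsq n p h
    have hpn' : p ≤ n := (Nat.le_mul_of_pos_left p hp).trans hpn
    obtain ⟨S, hS, A, hA⟩ := GraphStream.exists_detAlgorithm hp hpn
    refine ⟨S, ?_, A.ofTurnstile, fun G hG s σ hσ => ?_⟩
    · have h0 : 0 ≤ Real.log n := Real.log_natCast_nonneg n
      calc (S : ℝ) ≤ 20 * GraphStream.logBits n * (n * GraphStream.share n p) := by exact_mod_cast hS
        _ ≤ 20 * (2 * (1 + Real.log n)) * (n * (2 * (n / p))) := by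
          gcongr
          · exact GraphStream.logBits_le (by omega)
          · exact GraphStream.share_le hp hpn'
        _ = _ := by ring
    · rw [GraphStream.DetAlgorithm.run_ofTurnstile]
      exact hA G hG s _ hσ.isTurnstileStream
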